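/- Work over the field $\mathbb K=\mathbb R$ or $\mathbb C$. A Fréchet space is a complete, metrisable, locally convex topological vector space, and $\hat\otimes$ denotes the complete projective topological tensor product. An extension of Fréchet spaces is a diagram $I\xrightarrow{i}E\xrightarrow{p}Q$ of continuous linear maps between Fréchet spaces such that $i$ is a homeomorphism onto $\ker p$ and $p$ is an open surjection. It is called ind-locally split if every compact linear map $V\to Q$ from a Banach space $V$ lifts to a continuous linear map $V\to E$, and pro-locally split if every continuous linear map $I\to V$ to a Banach space $V$ extends to a continuous linear map $E\to V$. A locally convex space $Q$ is nuclear if for each continuous seminorm $p$ on $Q$ there is a continuous seminorm $q\ge p$ such that the canonical map $\hat Q_q\to\hat Q_p$ between the Banach space completions of $Q$ with respect to $q$ and $p$ is a nuclear map. Theorem. Let $I\xrightarrow{i} E\xrightarrow{p} Q$ be an extension of Fréchet spaces. If $Q$ is nuclear, then: (1) the extension is pure: for every Fréchet space $V$, the diagram $I\mathbin{\hat\otimes}V\to E\mathbin{\hat\otimes}V\to Q\mathbin{\hat\otimes}V$ is an extension of Fréchet spaces; (2) the extension is pure ind-locally split: it is ind-locally split, and so is $I\mathbin{\hat\otimes}V\to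 E\mathbin{\hat\otimes}V\to Q\mathbin{\hat\otimes}V$ for every Fréchet space $V$; (3) the extension is pure pro-locally split: it is pro-locally split, and so is $I\mathbin{\hat\otimes}V\to E\mathbin{\hat\otimes}V\to Q\mathbin{\hat\otimes}V$ for every Fréchet space $V$. -/

import Mathlib

open Topology TopologicalSpace UniformSpace
open scoped TensorProduct Uniformity

universe u₁ u₂ u₃ u₄ v w

noncomputable section

namespace FrechetExt

/-! ## Fréchet spaces -/

/-- A Fréchet space over `𝕜 = ℝ` or `ℂ`: a topological vector space which is locally convex
(its topology is given by its continuous seminorms), complete and metrisable.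
The uniform structure is the canonical one of the additive topological group `E`
(this is what `IsUniformAddGroup E` says). -/
class FrechetSpace (𝕜 : Type u₁) (E : Type u₂) [RCLike 𝕜] [AddCommGroup E] [Module 𝕜 E]
    [UniformSpace E] [IsUniformAddGroup E] : Prop
    extends ContinuousSMul 𝕜 E, PolynormableSpace 𝕜 E where
  complete : CompleteSpace E
  metrizable : MetrizableSpace E

/-! ## The projective tensor product of locally convex spaces -/

section ProjSeminorm

variable {𝕜 : Type u₁} [RCLike 𝕜]
variable {E : Type u₂} [AddCommGroup E] [Module 𝕜 E]
variable {F : Type u₃} [AddCommGroup F] [Module 𝕜 F]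

/-- The element `∑ xₖ ⊗ yₖ` represented by a finite list of pairs `(xₖ, yₖ)`. -/
def tensorSum (𝕜 : Type u₁) [RCLike 𝕜] {E : Type u₂} [AddCommGroup E] [Module 𝕜 E]
    {F : Type u₃} [AddCommGroup F] [Module 𝕜 F] (l : List (E × F)) : E ⊗[𝕜] F :=
  (l.map fun a => a.1 ⊗ₜ[𝕜] a.2).sum

/-- The number `∑ p(xₖ) q(yₖ)` for a finite list of pairs `(xₖ, yₖ)`. -/
def costSum (p : Seminorm 𝕜 E) (q : Seminorm 𝕜 F) (l : List (E × F)) : ℝ :=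
  (l.map fun a => p a.1 * q a.2).sum

theorem costSum_nonneg (p : Seminorm 𝕜 E) (q : Seminorm 𝕜 F) (l : List (E × F)) :
    0 ≤ costSum p q l := by
  refine List.sum_nonneg fun a ha => ?_
  obtain ⟨b, -, rfl⟩ := List.mem_map.1 ha
  positivity

theorem exists_tensorSum_eq (z : E ⊗[𝕜] F) : ∃ l : List (E × F), tensorSum 𝕜 l = z := by
  induction z using TensorProduct.induction_on with
  | zero => exact ⟨[], by simp [tensorSum]⟩
  | tmul x y => exact ⟨[(x, y)], by simp [tensorSum]⟩
  | add z₁ z₂ h₁ h₂ =>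
    obtain ⟨l₁, rfl⟩ := h₁
    obtain ⟨l₂, rfl⟩ := h₂
    exact ⟨l₁ ++ l₂, by simp [tensorSum]⟩

theorem bddBelow_cost (p : Seminorm 𝕜 E) (q : Seminorm 𝕜 F) (z : E ⊗[𝕜] F) :
    BddBelow (Set.range fun l : {l : List (E × F) // tensorSum 𝕜 l = z} => costSum p q l.1) := by
  refine ⟨0, ?_⟩
  rintro _ ⟨l, rfl⟩
  exact costSum_nonneg p q l.1

instance (z : E ⊗[𝕜] F) : Nonempty {l : List (E × F) // tensorSum 𝕜 l = z} :=
  let ⟨l, hl⟩ := exists_tensorSum_eq z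
  ⟨⟨l, hl⟩⟩

/-- The projective tensor product `p ⊗ q` of two seminorms on the algebraic tensor product:
`(p ⊗ q)(z) = inf ∑ p(xₖ) q(yₖ)`, the infimum over all representations `z = ∑ xₖ ⊗ yₖ`
as a finite sum. -/
def projSeminorm (p : Seminorm 𝕜 E) (q : Seminorm 𝕜 F) : Seminorm 𝕜 (E ⊗[𝕜] F) :=
  Seminorm.ofSMulLE
    (fun z => ⨅ l : {l : List (E × F) // tensorSum 𝕜 l = z}, costSum p q l.1)
    (by
      refine le_antisymm ?_ (le_ciInf fun l => costSum_nonneg p q l.1)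
      exact ciInf_le_of_le (bddBelow_cost p q 0) ⟨[], by simp [tensorSum]⟩ (by simp [costSum]))
    (fun z₁ z₂ => le_ciInf_add_ciInf fun l₁ l₂ =>
      ciInf_le_of_le (bddBelow_cost p q (z₁ + z₂))
        ⟨l₁.1 ++ l₂.1, by
          have h₁ := l₁.2
          have h₂ := l₂.2
          simp only [tensorSum] at h₁ h₂
          simp [tensorSum, h₁, h₂]⟩ (by simp [costSum]))
    (fun c z => by
      rw [Real.mul_iInf_of_nonneg (norm_nonneg c)]
      refine le_ciInf fun l => ?_
      refine ciInf_le_of_le (bddBelow_cost p q (c • z))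
        ⟨l.1.map fun a => (c • a.1, a.2), ?_⟩ (le_of_eq ?_)
      · conv_rhs => rw [← l.2]
        simp [tensorSum, List.smul_sum, Function.comp_def, TensorProduct.smul_tmul']
      · simp [costSum, Function.comp_def, map_smul_eq_mul, mul_assoc, List.sum_map_mul_left])

theorem projSeminorm_le (p : Seminorm 𝕜 E) (q : Seminorm 𝕜 F) (l : List (E × F)) :
    projSeminorm p q (tensorSum 𝕜 l) ≤ costSum p q l :=
  ciInf_le (bddBelow_cost p q _) ⟨l, rfl⟩

theorem le_projSeminorm (p : Seminorm 𝕜 E) (q : Seminorm 𝕜 F) (z : E ⊗[𝕜] F) {c : ℝ}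
    (h : ∀ l : List (E × F), tensorSum 𝕜 l = z → c ≤ costSum p q l) : c ≤ projSeminorm p q z :=
  le_ciInf fun l => h l.1 l.2

theorem projSeminorm_mono {p p' : Seminorm 𝕜 E} {q q' : Seminorm 𝕜 F} (hp : p ≤ p')
    (hq : q ≤ q') : projSeminorm p q ≤ projSeminorm p' q' := by
  intro z
  refine le_projSeminorm _ _ _ fun l hl => ?_
  rw [← hl]
  refine (projSeminorm_le p q l).trans (List.sum_le_sum fun a _ => ?_)
  exact mul_le_mul (hp _) (hq _) (apply_nonneg _ _) (apply_nonneg _ _)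

end ProjSeminorm

section ProjTensor

variable (𝕜 : Type u₁) [RCLike 𝕜]
variable (E : Type u₂) [AddCommGroup E] [Module 𝕜 E] [TopologicalSpace E]
variable (F : Type u₃) [AddCommGroup F] [Module 𝕜 F] [TopologicalSpace F]

/-- The algebraic tensor product `E ⊗ F` of two topological vector spaces, to be equipped with
the projective topology. -/
def ProjTensor : Type (max u₂ u₃) := E ⊗[𝕜] F

instance : AddCommGroup (ProjTensor 𝕜 E F) := inferInstanceAs (AddCommGroup (E ⊗[𝕜] F))

instance : Module 𝕜 (ProjTensor 𝕜 E F) := inferInstanceAs (Module 𝕜 (E ⊗[𝕜] F))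

instance : Nonempty {p : Seminorm 𝕜 E // Continuous p} := ⟨⟨0, continuous_const⟩⟩

/-- The family of all seminorms `p ⊗ q` with `p` and `q` continuous seminorms. -/
def projFamily : SeminormFamily 𝕜 (ProjTensor 𝕜 E F)
    ({p : Seminorm 𝕜 E // Continuous p} × {q : Seminorm 𝕜 F // Continuous q}) :=
  fun a => projSeminorm a.1.1 a.2.1

/-- The projective topology, generated by the seminorms `p ⊗ q`. -/
instance : TopologicalSpace (ProjTensor 𝕜 E F) := (projFamily 𝕜 E F).moduleFilterBasis.topology

theorem withSeminorms_projFamily : WithSeminorms (projFamily 𝕜 E F) := ⟨rfl⟩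

instance : IsTopologicalAddGroup (ProjTensor 𝕜 E F) :=
  (withSeminorms_projFamily 𝕜 E F).topologicalAddGroup

instance : ContinuousSMul 𝕜 (ProjTensor 𝕜 E F) :=
  (withSeminorms_projFamily 𝕜 E F).continuousSMul

instance : PolynormableSpace 𝕜 (ProjTensor 𝕜 E F) :=
  (withSeminorms_projFamily 𝕜 E F).toPolynormableSpace

/-- The uniform structure of the topological group `E ⊗ F`. -/
instance : UniformSpace (ProjTensor 𝕜 E F) :=
  IsTopologicalAddGroup.rightUniformSpace (ProjTensor 𝕜 E F)

instance : IsUniformAddGroup (ProjTensor 𝕜 E F) := isUniformAddGroup_of_addCommGroup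

instance : UniformContinuousConstSMul 𝕜 (ProjTensor 𝕜 E F) :=
  uniformContinuousConstSMul_of_continuousConstSMul 𝕜 (ProjTensor 𝕜 E F)

/-- The complete projective topological tensor product `E ⊗̂ F`: the (Hausdorff) completion of the
algebraic tensor product for the projective topology. -/
abbrev CompletedTensor : Type (max u₂ u₃) := Completion (ProjTensor 𝕜 E F)

end ProjTensor

section Map

variable {𝕜 : Type u₁} [RCLike 𝕜]
theorem projSeminorm_rTensor_le {E : Type u₂} [AddCommGroup E] [Module 𝕜 E]
    {F : Type u₃} [AddCommGroup F] [Module 𝕜 F] (f : E →ₗ[𝕜] F) {V : Type v} [AddCommGroup V] [Module 𝕜 V]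
    (p : Seminorm 𝕜 F) (q : Seminorm 𝕜 V) (z : E ⊗[𝕜] V) :
    projSeminorm p q (f.rTensor V z) ≤ projSeminorm (p.comp f) q z := by
  refine le_projSeminorm _ _ _ fun l hl => ?_
  have h : f.rTensor V z = tensorSum 𝕜 (l.map fun a => (f a.1, a.2)) := by
    rw [← hl]
    simp [tensorSum, map_list_sum, Function.comp_def]
  rw [h]
  refine (projSeminorm_le p q _).trans (le_of_eq ?_)
  simp [costSum, Function.comp_def]

variable {E : Type u₂} [AddCommGroup E] [Module 𝕜 E] [TopologicalSpace E]
variable {F : Type u₃} [AddCommGroup F] [Module 𝕜 F] [TopologicalSpace F]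

/-- The continuous linear map `f ⊗ id_V : E ⊗ V → F ⊗ V` for the projective topologies. -/
def rTensorL (f : E →L[𝕜] F) (V : Type v) [AddCommGroup V] [Module 𝕜 V] [TopologicalSpace V] :
    ProjTensor 𝕜 E V →L[𝕜] ProjTensor 𝕜 F V where
  toLinearMap := (f : E →ₗ[𝕜] F).rTensor V
  cont := by
    refine WithSeminorms.continuous_of_isBounded (withSeminorms_projFamily 𝕜 E V)
      (withSeminorms_projFamily 𝕜 F V) (LinearMap.rTensor V (f : E →ₗ[𝕜] F)) fun a => ?_
    refine ⟨{(⟨a.1.1.comp (f : E →ₗ[𝕜] F), a.1.2.comp f.continuous⟩, a.2)}, 1, fun z => ?_⟩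
    rw [Finset.sup_singleton, one_smul]
    exact projSeminorm_rTensor_le (f : E →ₗ[𝕜] F) a.1.1 a.2.1 z

/-- The continuous linear map `f ⊗̂ id_V : E ⊗̂ V → F ⊗̂ V`. -/
def tensorMap (f : E →L[𝕜] F) (V : Type v) [AddCommGroup V] [Module 𝕜 V] [TopologicalSpace V] :
    CompletedTensor 𝕜 E V →L[𝕜] CompletedTensor 𝕜 F V :=
  (rTensorL f V).completion

/-- The elementary tensor `x ⊗ y`, as an element of `E ⊗̂ F`. -/
def tmul (𝕜 : Type u₁) [RCLike 𝕜] {E : Type u₂} [AddCommGroup E] [Module 𝕜 E] [TopologicalSpace E]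
    {F : Type u₃} [AddCommGroup F] [Module 𝕜 F] [TopologicalSpace F] (x : E) (y : F) :
    CompletedTensor 𝕜 E F :=
  Completion.coe' (α := ProjTensor 𝕜 E F) (x ⊗ₜ[𝕜] y : E ⊗[𝕜] F)

theorem tensorMap_tmul (f : E →L[𝕜] F) {V : Type v} [AddCommGroup V] [Module 𝕜 V]
    [TopologicalSpace V] (x : E) (y : V) : tensorMap f V (tmul 𝕜 x y) = tmul 𝕜 (f x) y :=
  ContinuousLinearMap.completion_apply_coe (rTensorL f V) (x ⊗ₜ[𝕜] y : E ⊗[𝕜] V)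

end Map

/-! ## The complete projective tensor product of Fréchet spaces is a Fréchet space -/

section Frechet

variable {𝕜 : Type u₁} [RCLike 𝕜]

theorem Seminorm.le_of_ball_subset {E : Type u₂} [AddCommGroup E] [Module 𝕜 E]
    (p q : Seminorm 𝕜 E) (h : q.ball 0 1 ⊆ p.ball 0 1) : p ≤ q := by
  intro x
  refine le_of_forall_gt_imp_ge_of_dense fun c hc => ?_
  have hc0 : 0 < c := (apply_nonneg q x).trans_lt hc
  have hx : ((c⁻¹ : ℝ) : 𝕜) • x ∈ p.ball 0 1 := by
    refine h ?_
    rw [Seminorm.mem_ball_zero, map_smul_eq_mul, RCLike.norm_ofReal, abs_of_pos (inv_pos.2 hc0),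
      inv_mul_lt_iff₀ hc0, mul_one]
    exact hc
  rw [Seminorm.mem_ball_zero, map_smul_eq_mul, RCLike.norm_ofReal, abs_of_pos (inv_pos.2 hc0),
      inv_mul_lt_iff₀ hc0, mul_one] at hx
  exact hx.le

theorem exists_seq_seminorm (𝕜 : Type u₁) [RCLike 𝕜] (E : Type u₂) [AddCommGroup E] [Module 𝕜 E]
    [TopologicalSpace E] [PolynormableSpace 𝕜 E] [FirstCountableTopology E] :
    ∃ P : ℕ → {p : Seminorm 𝕜 E // Continuous p},
      ∀ p : Seminorm 𝕜 E, Continuous p → ∃ n, p ≤ (P n).1 := by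
  obtain ⟨U, hU⟩ := (𝓝 (0 : E)).exists_antitone_basis
  have hmem : ∀ n, ∃ p : {p : Seminorm 𝕜 E // Continuous p}, p.1.ball 0 1 ⊆ U n := by
    intro n
    obtain ⟨s, r, hr, hs⟩ := ((PolynormableSpace.withSeminorms 𝕜 E).mem_nhds_iff 0 (U n)).1
      (hU.1.mem_of_mem trivial)
    set t : Seminorm 𝕜 E := s.sup fun p : {p : Seminorm 𝕜 E // Continuous p} => p.1 with ht
    have htc : Continuous t := by
      have := (PolynormableSpace.withSeminorms 𝕜 E).topologicalAddGroup
      have := (PolynormableSpace.withSeminorms 𝕜 E).continuousSMul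
      refine Seminorm.continuous (r := 1) ?_
      exact ((PolynormableSpace.withSeminorms 𝕜 E).mem_nhds_iff 0 _).2 ⟨s, 1, one_pos, le_rfl⟩
    refine ⟨⟨Real.toNNReal r⁻¹ • t, ?_⟩, fun x hx => hs ?_⟩
    · exact htc.const_smul (Real.toNNReal r⁻¹)
    · rw [Seminorm.mem_ball_zero] at hx ⊢
      have hx' : (Real.toNNReal r⁻¹ : ℝ) * t x < 1 := hx
      rw [Real.coe_toNNReal _ (inv_pos.2 hr).le] at hx'
      rwa [inv_mul_lt_iff₀ hr, mul_one] at hx'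
  choose P hP using hmem
  refine ⟨P, fun p hp => ?_⟩
  obtain ⟨n, -, hn⟩ := hU.1.mem_iff.1 (p.ball_mem_nhds hp one_pos)
  exact ⟨n, Seminorm.le_of_ball_subset _ _ ((hP n).trans hn)⟩

instance {E : Type u₂} [AddCommGroup E] [Module 𝕜 E] [TopologicalSpace E]
    {F : Type u₃} [AddCommGroup F] [Module 𝕜 F] [TopologicalSpace F]
    [PolynormableSpace 𝕜 E] [FirstCountableTopology E]
    [PolynormableSpace 𝕜 F] [FirstCountableTopology F] :
    FirstCountableTopology (ProjTensor 𝕜 E F) := by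
  obtain ⟨P, hP⟩ := exists_seq_seminorm 𝕜 E
  obtain ⟨Q, hQ⟩ := exists_seq_seminorm 𝕜 F
  let R : SeminormFamily 𝕜 (ProjTensor 𝕜 E F) (ℕ × ℕ) := fun a => projFamily 𝕜 E F (P a.1, Q a.2)
  have hR : WithSeminorms R := by
    refine (withSeminorms_projFamily 𝕜 E F).congr (fun a => ?_) (fun a => ?_)
    · exact ⟨{(P a.1, Q a.2)}, 1, by rw [Finset.sup_singleton, one_smul]; exact fun z => le_rfl⟩
    · obtain ⟨n, hn⟩ := hP a.1.1 a.1.2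
      obtain ⟨m, hm⟩ := hQ a.2.1 a.2.2
      refine ⟨{(n, m)}, 1, ?_⟩
      rw [Finset.sup_singleton, one_smul]
      exact fun z => projSeminorm_mono hn hm z
  exact hR.firstCountableTopology

theorem completion_hasBasis {X : Type u₂} [AddCommGroup X] [UniformSpace X]
    {ι : Type w} {P : ι → Prop} {s : ι → Set X} (h : (𝓝 (0 : X)).HasBasis P s) :
    (𝓝 (0 : Completion X)).HasBasis P
      fun i => closure ((fun x : X => (x : Completion X)) '' s i) := by
  rw [← Completion.coe_zero (α := X)]
  exact h.hasBasis_of_isDenseInducing Completion.isDenseInducing_coe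

theorem completion_metrizable (X : Type u₂) [AddCommGroup X] [UniformSpace X]
    [IsUniformAddGroup X] [FirstCountableTopology X] : MetrizableSpace (Completion X) := by
  obtain ⟨U, hU⟩ := (𝓝 (0 : X)).exists_antitone_basis
  have : (𝓝 (0 : Completion X)).IsCountablyGenerated :=
    Filter.HasCountableBasis.isCountablyGenerated
      ⟨completion_hasBasis hU.1, Set.to_countable _⟩
  have : (𝓤 (Completion X)).IsCountablyGenerated :=
    IsUniformAddGroup.uniformity_countably_generated
  exact UniformSpace.metrizableSpace

section

variable {X : Type u₂} [AddCommGroup X] [Module 𝕜 X] [UniformSpace X] [IsUniformAddGroup X]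

theorem uniformContinuous_seminorm (p : {p : Seminorm 𝕜 X // Continuous p}) :
    UniformContinuous p.1 :=
  Seminorm.uniformContinuous_of_continuousAt_zero p.2.continuousAt

variable [UniformContinuousConstSMul 𝕜 X]

/-- The extension of a continuous seminorm to the completion. -/
def completionSeminorm (p : {p : Seminorm 𝕜 X // Continuous p}) : Seminorm 𝕜 (Completion X) :=
  Seminorm.of (Completion.extension p.1)
    (fun x y => by
      have hc : Continuous (Completion.extension p.1) := Completion.continuous_extension
      induction x, y using Completion.induction_on₂ with
      | hp => exact isClosed_le (by fun_prop) (by fun_prop)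
      | ih x y =>
        rw [← Completion.coe_add]
        simp only [Completion.extension_coe (uniformContinuous_seminorm p)]
        exact map_add_le_add p.1 x y)
    (fun c x => by
      have hc : Continuous (Completion.extension p.1) := Completion.continuous_extension
      induction x using Completion.induction_on with
      | hp => exact isClosed_eq (hc.comp (continuous_const_smul c)) (by fun_prop)
      | ih x =>
        rw [← Completion.coe_smul]
        simp only [Completion.extension_coe (uniformContinuous_seminorm p)]
        exact map_smul_eq_mul p.1 c x)

theorem continuous_completionSeminorm (p : {p : Seminorm 𝕜 X // Continuous p}) :
    Continuous (completionSeminorm p) :=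
  Completion.continuous_extension

theorem completionSeminorm_coe (p : {p : Seminorm 𝕜 X // Continuous p}) (x : X) :
    completionSeminorm p (x : Completion X) = p.1 x :=
  Completion.extension_coe (uniformContinuous_seminorm p) x

theorem completion_polynormable [PolynormableSpace 𝕜 X] :
    PolynormableSpace 𝕜 (Completion X) := by
  have hX := PolynormableSpace.withSeminorms 𝕜 X
  have key : WithSeminorms
      (completionSeminorm : SeminormFamily 𝕜 (Completion X) {p : Seminorm 𝕜 X // Continuous p}) := by
    rw [SeminormFamily.withSeminorms_iff_nhds_eq_iInf]
    refine le_antisymm ?_ ?_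
    · refine le_iInf fun p => Filter.tendsto_iff_comap.1 ?_
      exact (continuous_completionSeminorm p).tendsto' 0 0 (map_zero _)
    · refine (completion_hasBasis hX.hasBasis_zero_ball).ge_iff.2 ?_
      rintro ⟨s, r⟩ hr
      have h1 : (⋂ p ∈ s, (completionSeminorm p).ball (0 : Completion X) r) ⊆
          closure ((fun x : X => (x : Completion X)) ''
            (s.sup fun p : {p : Seminorm 𝕜 X // Continuous p} => p.1).ball 0 r) := by
        have ho : IsOpen (⋂ p ∈ s, (completionSeminorm p).ball (0 : Completion X) r) := by
          refine isOpen_biInter_finset fun p _ => ?_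
          rw [Seminorm.ball_zero_eq]
          exact isOpen_lt (continuous_completionSeminorm p) continuous_const
        refine (Completion.denseRange_coe.open_subset_closure_inter ho).trans (closure_mono ?_)
        rintro _ ⟨hx, x, rfl⟩
        refine ⟨x, ?_, rfl⟩
        rw [Seminorm.mem_ball_zero]
        refine Seminorm.finset_sup_apply_lt hr fun p hp => ?_
        have := Set.mem_iInter₂.1 hx p hp
        rwa [Seminorm.mem_ball_zero, completionSeminorm_coe] at this
      refine Filter.mem_of_superset ?_ h1
      refine (Filter.biInter_finset_mem s).2 fun p _ => Filter.mem_iInf_of_mem p ?_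
      refine ⟨Set.Iio r, Iio_mem_nhds hr, fun x hx => ?_⟩
      rw [Seminorm.mem_ball_zero]
      exact hx
  exact key.toPolynormableSpace

end

end Frechet

/-- `E ⊗̂ F` is a Fréchet space if `E` and `F` are. -/
instance {𝕜 : Type u₁} [RCLike 𝕜]
    {E : Type u₂} [AddCommGroup E] [Module 𝕜 E] [UniformSpace E] [IsUniformAddGroup E]
    {F : Type u₃} [AddCommGroup F] [Module 𝕜 F] [UniformSpace F] [IsUniformAddGroup F]
    [hE : FrechetSpace 𝕜 E] [hF : FrechetSpace 𝕜 F] :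
    FrechetSpace 𝕜 (CompletedTensor 𝕜 E F) :=
  have := hE.metrizable
  have := hF.metrizable
  have hP : PolynormableSpace 𝕜 (CompletedTensor 𝕜 E F) := completion_polynormable
  { toContinuousSMul := (PolynormableSpace.withSeminorms 𝕜 (CompletedTensor 𝕜 E F)).continuousSMul
    toPolynormableSpace := hP
    complete := inferInstance
    metrizable := completion_metrizable (ProjTensor 𝕜 E F) }

/-! ## Nuclear maps and nuclear spaces -/

section Nuclear

variable {𝕜 : Type u₁} [RCLike 𝕜]

/-- A continuous linear map `T : X → Y` between Banach spaces is nuclear if it is given by an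
element of `X* ⊗̂ Y`, that is, `T x = ∑ fₙ(x) yₙ` with `fₙ ∈ X*`, `yₙ ∈ Y` and
`∑ ‖fₙ‖ ‖yₙ‖ < ∞`. -/
def IsNuclearMap {X : Type u₂} [NormedAddCommGroup X] [NormedSpace 𝕜 X]
    {Y : Type u₃} [NormedAddCommGroup Y] [NormedSpace 𝕜 Y] (T : X →L[𝕜] Y) : Prop :=
  ∃ (f : ℕ → X →L[𝕜] 𝕜) (y : ℕ → Y),
    Summable (fun n => ‖f n‖ * ‖y n‖) ∧ ∀ x : X, HasSum (fun n => f n x • y n) (T x)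

variable {E : Type u₂} [AddCommGroup E] [Module 𝕜 E]

/-- The vector space `E` with the topology given by the single seminorm `p`. -/
def SeminormedBy (_p : Seminorm 𝕜 E) : Type u₂ := E

instance (p : Seminorm 𝕜 E) : SeminormedAddCommGroup (SeminormedBy p) :=
  p.toAddGroupSeminorm.toSeminormedAddCommGroup

instance (p : Seminorm 𝕜 E) : Module 𝕜 (SeminormedBy p) := inferInstanceAs (Module 𝕜 E)

instance (p : Seminorm 𝕜 E) : NormedSpace 𝕜 (SeminormedBy p) where
  norm_smul_le c x := (map_smul_eq_mul p c x).le

/-- The Banach space `Ê_p`: the (Hausdorff) completion of `E` for the seminorm `p`. -/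
abbrev LocalBanach (p : Seminorm 𝕜 E) : Type u₂ := Completion (SeminormedBy p)

/-- The identity map of `E`, as a contraction `(E, q) → (E, p)` for `p ≤ q`. -/
def seminormedByMap {p q : Seminorm 𝕜 E} (h : p ≤ q) : SeminormedBy q →L[𝕜] SeminormedBy p :=
  LinearMap.mkContinuous (LinearMap.id : E →ₗ[𝕜] E) 1 fun x => (h x).trans (one_mul (q x)).ge

/-- The canonical map `Ê_q → Ê_p` for `p ≤ q`. -/
def localMap {p q : Seminorm 𝕜 E} (h : p ≤ q) : LocalBanach q →L[𝕜] LocalBanach p :=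
  (seminormedByMap h).completion

/-- A locally convex space `E` is nuclear if the projective system of the Banach spaces `Ê_p`
is nuclear: for each continuous seminorm `p` there is a continuous seminorm `q ≥ p` such that
`Ê_q → Ê_p` is nuclear. -/
def IsNuclearSpace (𝕜 : Type u₁) [RCLike 𝕜] (E : Type u₂) [AddCommGroup E] [Module 𝕜 E]
    [TopologicalSpace E] : Prop :=
  ∀ p : Seminorm 𝕜 E, Continuous p →
    ∃ q : Seminorm 𝕜 E, Continuous q ∧ ∃ h : p ≤ q, IsNuclearMap (localMap h)

end Nuclear

/-! ## Extensions -/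

section Extension

/- The following notions are used for Fréchet spaces `I`, `E`, `Q`; only the topologies enter. -/

variable {𝕜 : Type u₁} [RCLike 𝕜]
variable {I : Type u₂} [AddCommGroup I] [Module 𝕜 I] [TopologicalSpace I]
variable {E : Type u₃} [AddCommGroup E] [Module 𝕜 E] [TopologicalSpace E]
variable {Q : Type u₄} [AddCommGroup Q] [Module 𝕜 Q] [TopologicalSpace Q]

/-- `I → E → Q` is an extension of Fréchet spaces: `i` is a kernel of `p`, that is, a
homeomorphism onto `ker p`, and `p` is a cokernel of `i`, that is, an open surjection with
kernel `i(I)`. -/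
structure IsExtension (i : I →L[𝕜] E) (p : E →L[𝕜] Q) : Prop where
  isEmbedding : IsEmbedding i
  exact : Function.Exact i p
  surjective : Function.Surjective p
  isOpenMap : IsOpenMap p

/-- An extension of Fréchet spaces is ind-locally split if each compact linear map `V → Q` from a
Banach space `V` lifts to a continuous linear map `V → E`. -/
structure IsIndLocallySplit (i : I →L[𝕜] E) (p : E →L[𝕜] Q) : Prop where
  isExtension : IsExtension i p
  lift : ∀ (V : Type w) [NormedAddCommGroup V] [NormedSpace 𝕜 V] [CompleteSpace V]
    (f : V →L[𝕜] Q), IsCompactOperator f → ∃ g : V →L[𝕜] E, p.comp g = f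

/-- An extension of Fréchet spaces is pro-locally split if each continuous linear map `I → V` to a
Banach space `V` extends to a continuous linear map `E → V`. -/
structure IsProLocallySplit (i : I →L[𝕜] E) (p : E →L[𝕜] Q) : Prop where
  isExtension : IsExtension i p
  extend : ∀ (V : Type w) [NormedAddCommGroup V] [NormedSpace 𝕜 V] [CompleteSpace V]
    (f : I →L[𝕜] V), ∃ g : E →L[𝕜] V, g.comp i = f

/-- An extension of Fréchet spaces is pure if `I ⊗̂ V → E ⊗̂ V → Q ⊗̂ V` is again an extension for
each Fréchet space `V`. -/
structure IsPure (i : I →L[𝕜] E) (p : E →L[𝕜] Q) : Prop where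
  isExtension : IsExtension i p
  tensor : ∀ (V : Type v) [AddCommGroup V] [Module 𝕜 V] [UniformSpace V] [IsUniformAddGroup V]
    [FrechetSpace 𝕜 V], IsExtension (tensorMap i V) (tensorMap p V)

/-- Purity for the exact structure of ind-locally split extensions: `I → E → Q` is ind-locally
split, and so is `I ⊗̂ V → E ⊗̂ V → Q ⊗̂ V` for each Fréchet space `V`. -/
structure IsPureIndLocallySplit (i : I →L[𝕜] E) (p : E →L[𝕜] Q) : Prop where
  isIndLocallySplit : IsIndLocallySplit.{u₁, u₂, u₃, u₄, w} i p
  tensor : ∀ (V : Type v) [AddCommGroup V] [Module 𝕜 V] [UniformSpace V] [IsUniformAddGroup V]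
    [FrechetSpace 𝕜 V],
    IsIndLocallySplit.{u₁, max u₂ v, max u₃ v, max u₄ v, w} (tensorMap i V) (tensorMap p V)

/-- Purity for the exact structure of pro-locally split extensions: `I → E → Q` is pro-locally
split, and so is `I ⊗̂ V → E ⊗̂ V → Q ⊗̂ V` for each Fréchet space `V`. -/
structure IsPureProLocallySplit (i : I →L[𝕜] E) (p : E →L[𝕜] Q) : Prop where
  isProLocallySplit : IsProLocallySplit.{u₁, u₂, u₃, u₄, w} i p
  tensor : ∀ (V : Type v) [AddCommGroup V] [Module 𝕜 V] [UniformSpace V] [IsUniformAddGroup V]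
    [FrechetSpace 𝕜 V],
    IsProLocallySplit.{u₁, max u₂ v, max u₃ v, max u₄ v, w} (tensorMap i V) (tensorMap p V)

end Extension

end FrechetExt

end

/-!
Let `I → E → Q` be an extension of Fréchet spaces with `Q` nuclear. Nuclearity enters in two ways.

*Lifting.* The identity of `Q` is approximated by operators of finite rank with controlled nuclear
norm (`IsNuclearSpace.exists_finiteRank_approx`). Such operators lift to operators `Q → E` with the
corresponding bounds, which makes `p` approximately liftable (`ApproxLiftable`,
`IsNuclearSpace.approxLiftable`). Unlike nuclearity of the quotient, this property is inherited by
`p ⊗̂ W` for any `W` (`ApproxLiftable.tensorMap`): tensor the operators with the identity of `W`.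
Successive approximation then lifts every continuous linear map from a normed space to the quotient
(`ApproxLiftable.exists_lift`); it does not have to be compact.

*Extending.* Nuclear maps between Banach spaces lift along surjections of Banach spaces. Applied to
local Banach spaces of `Q` and `E`, this extends the canonical map from `I` to any of its local
Banach spaces to `E` (`IsExtension.exists_extend_toLocal`), and so it extends all maps from `I` to
Banach spaces. A continuous linear map from `I ⊗̂ W` to a Banach space `V` amounts to a map from `I`
to a Banach space of operators `Ŵ_q → V`, so these extend to `E ⊗̂ W` as well
(`IsExtension.exists_extend_bilinear`).

Purity follows. For the local Banach spaces `V` of `I ⊗ W`, the last statement says that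
`I ⊗ W → E ⊗ W` is a topological embedding. The rest holds for every extension:
`E ⊗ W → Q ⊗ W` is open, and the completion of an open surjection of first countable groups is an open
surjection with kernel the closure of the given kernel (`completion_isOpenMap_surjective_ker`).
-/

namespace FrechetExt

/-! ### Completions of open surjections -/

section CompletionOfQuotient

variable {𝕜 : Type u₁} [RCLike 𝕜]
variable {X : Type u₂} [AddCommGroup X] [Module 𝕜 X] [UniformSpace X] [IsUniformAddGroup X]
  [UniformContinuousConstSMul 𝕜 X] [FirstCountableTopology X]
variable {Y : Type u₃} [AddCommGroup Y] [Module 𝕜 Y] [UniformSpace Y] [IsUniformAddGroup Y]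
  [UniformContinuousConstSMul 𝕜 Y]

/-- Completion turns an open surjection of first countable groups into an open surjection, whose
kernel is the closure of the original kernel. With `K` that closure, `X̂ ⧸ K` is complete because
`X̂` is first countable, so `Y → X̂ ⧸ K` extends to `Ŷ`, and the extension is inverse to the map
`X̂ ⧸ K → Ŷ` induced by `f.completion`. -/
theorem completion_isOpenMap_surjective_ker (f : X →L[𝕜] Y) (ho : IsOpenMap f)
    (hs : Function.Surjective f) :
    IsOpenMap f.completion ∧ Function.Surjective f.completion ∧
      ∀ z, f.completion z = 0 →
        z ∈ closure ((fun x : X => (x : Completion X)) '' {x | f x = 0}) := by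
  have := completion_metrizable X
  let K : AddSubgroup (Completion X) :=
    ((f : X →+ Y).ker.map (Completion.toCompl : X →+ Completion X)).topologicalClosure
  have hKc : IsClosed (K : Set (Completion X)) := AddSubgroup.isClosed_topologicalClosure _
  have hKset : (K : Set (Completion X)) =
      closure ((fun x : X => (x : Completion X)) '' {x | f x = 0}) := rfl
  let _ : UniformSpace (Completion X ⧸ K) :=
    IsTopologicalAddGroup.rightUniformSpace (Completion X ⧸ K)
  have : IsUniformAddGroup (Completion X ⧸ K) := isUniformAddGroup_of_addCommGroup
  have hK : ∀ z ∈ K, f.completion z = 0 := by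
    intro z hz
    refine closure_minimal (s := (fun x : X => (x : Completion X)) '' {x | f x = 0})
      (t := {z | f.completion z = 0}) ?_
      (isClosed_eq f.completion.continuous continuous_const) hz
    rintro _ ⟨x, hx, rfl⟩
    have hx' : f x = 0 := hx
    simp [hx', Completion.coe_zero]
  let g : X →+ Completion X ⧸ K := (QuotientAddGroup.mk' K).comp Completion.toCompl
  have hgc : Continuous g := QuotientAddGroup.continuous_mk.comp (Completion.continuous_coe X)
  have hker : (f : X →+ Y).ker ≤ g.ker := by
    intro x hx
    refine (QuotientAddGroup.eq_zero_iff _).2 ?_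
    exact AddSubgroup.le_topologicalClosure _ ⟨x, hx, rfl⟩
  let ψ : Y →+ Completion X ⧸ K := (f : X →+ Y).liftOfSurjective hs ⟨g, hker⟩
  have hψ : ∀ x, ψ (f x) = g x := fun x => by
    exact AddMonoidHom.liftOfRightInverse_comp_apply (f : X →+ Y) _ _ ⟨g, hker⟩ x
  have hψc : Continuous ψ := by
    refine (ho.isQuotientMap f.continuous hs).continuous_iff.2 ?_
    exact hgc.congr fun x => (hψ x).symm
  let Ψ : Completion Y →+ Completion X ⧸ K := ψ.extension hψc
  have hΨc : Continuous Ψ := ψ.continuous_extension hψc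
  have h1 : ∀ z, Ψ (f.completion z) = QuotientAddGroup.mk' K z := by
    intro z
    induction z using Completion.induction_on with
    | hp => exact isClosed_eq (hΨc.comp f.completion.continuous) QuotientAddGroup.continuous_mk
    | ih x =>
      rw [ContinuousLinearMap.completion_apply_coe]
      exact (ψ.extension_coe hψc _).trans (hψ x)
  let fbar : Completion X ⧸ K →+ Completion Y :=
    QuotientAddGroup.lift K (f.completion : Completion X →+ Completion Y) hK
  have hfbar : Continuous fbar := by
    refine QuotientAddGroup.isOpenQuotientMap_mk.isQuotientMap.continuous_iff.2 ?_
    exact f.completion.continuous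
  have h2 : ∀ y, fbar (Ψ y) = y := by
    intro y
    induction y using Completion.induction_on with
    | hp => exact isClosed_eq (hfbar.comp hΨc) continuous_id
    | ih y =>
      obtain ⟨x, rfl⟩ := hs y
      have : Ψ (f x : Y) = g x := (ψ.extension_coe hψc _).trans (hψ x)
      rw [this]
      exact ContinuousLinearMap.completion_apply_coe f x
  refine ⟨fun U hU => ?_, fun y => ?_, fun z hz => ?_⟩
  · have : f.completion '' U = Ψ ⁻¹' (QuotientAddGroup.mk' K '' U) := by
      ext y
      constructor
      · rintro ⟨u, hu, rfl⟩
        exact ⟨u, hu, (h1 u).symm⟩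
      · rintro ⟨u, hu, huy⟩
        refine ⟨u, hu, ?_⟩
        rw [← h2 y, ← huy]
        rfl
    rw [this]
    exact (QuotientAddGroup.isOpenMap_coe U hU).preimage hΨc
  · obtain ⟨z, hz⟩ := QuotientAddGroup.mk'_surjective K (Ψ y)
    refine ⟨z, ?_⟩
    rw [← h2 y, ← hz]
    rfl
  · rw [← hKset]
    refine (QuotientAddGroup.eq_zero_iff _).1 ?_
    exact (h1 z).symm.trans (by rw [hz, map_zero])

end CompletionOfQuotient

/-! ### Quotient seminorms -/

section QuotientSeminorm

variable {𝕜 : Type u₁} [RCLike 𝕜]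
variable {E : Type u₂} [AddCommGroup E] [Module 𝕜 E]
variable {Q : Type u₃} [AddCommGroup Q] [Module 𝕜 Q]

/-- The quotient seminorm `y ↦ inf {s x | p x = y}` of `s` under a surjective linear map `p`. -/
noncomputable def quotSeminorm (p : E →ₗ[𝕜] Q) (hp : Function.Surjective p) (s : Seminorm 𝕜 E) :
    Seminorm 𝕜 Q :=
  have hb : ∀ y, BddBelow (Set.range fun x : {x : E // p x = y} => s x.1) := fun y =>
    ⟨0, by rintro _ ⟨x, rfl⟩; exact apply_nonneg s x.1⟩
  have hne : ∀ y, Nonempty {x : E // p x = y} := fun y => (hp y).elim fun x hx => ⟨x, hx⟩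
  Seminorm.ofSMulLE
    (fun y => ⨅ x : {x : E // p x = y}, s x.1)
    (le_antisymm (ciInf_le_of_le (hb 0) ⟨0, map_zero p⟩ (map_zero s).le)
      (have := hne 0; le_ciInf fun x => apply_nonneg s x.1))
    (fun y₁ y₂ => by
      have := hne y₁
      have := hne y₂
      exact le_ciInf_add_ciInf fun x₁ x₂ => ciInf_le_of_le (hb _)
        ⟨x₁.1 + x₂.1, by rw [map_add, x₁.2, x₂.2]⟩ (map_add_le_add s _ _))
    (fun c y => by
      have := hne y
      rw [Real.mul_iInf_of_nonneg (norm_nonneg c)]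
      exact le_ciInf fun x => ciInf_le_of_le (hb _) ⟨c • x.1, by rw [map_smul, x.2]⟩
        (map_smul_eq_mul s _ _).le)

variable (p : E →ₗ[𝕜] Q) (hp : Function.Surjective p) (s : Seminorm 𝕜 E)

theorem quotSeminorm_apply_le (x : E) : quotSeminorm p hp s (p x) ≤ s x :=
  ciInf_le (f := fun z : {z : E // p z = p x} => s z.1)
    ⟨0, by rintro _ ⟨x, rfl⟩; exact apply_nonneg s x.1⟩ ⟨x, rfl⟩

theorem exists_lift_lt_of_quotSeminorm_lt {y : Q} {c : ℝ} (h : quotSeminorm p hp s y < c) :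
    ∃ x, p x = y ∧ s x < c := by
  have : Nonempty {x : E // p x = y} := (hp y).elim fun x hx => ⟨x, hx⟩
  obtain ⟨x, hx⟩ := exists_lt_of_ciInf_lt (f := fun z : {z : E // p z = y} => s z.1) h
  exact ⟨x.1, x.2, hx⟩

theorem continuous_quotSeminorm [TopologicalSpace E] [TopologicalSpace Q]
    [IsTopologicalAddGroup Q] [ContinuousSMul 𝕜 Q] (ho : IsOpenMap p) (hs : Continuous s) :
    Continuous (quotSeminorm p hp s) := by
  refine Seminorm.continuous (r := 1) ?_
  have h := ho.image_mem_nhds (s.ball_mem_nhds hs one_pos)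
  rw [map_zero] at h
  refine Filter.mem_of_superset h ?_
  rintro _ ⟨x, hx, rfl⟩
  rw [Seminorm.mem_ball_zero] at hx ⊢
  exact (quotSeminorm_apply_le p hp s x).trans_lt hx

end QuotientSeminorm

/-! ### Seminorms on projective tensor products -/

section ProjHat

variable {𝕜 : Type u₁} [RCLike 𝕜]
variable {E : Type u₂} [AddCommGroup E] [Module 𝕜 E]
variable {W : Type v} [AddCommGroup W] [Module 𝕜 W]

/-- `s ⊗ w` is the largest seminorm bounded by `s x * w v` on elementary tensors. -/
theorem le_projSeminorm_of_tmul_le {s : Seminorm 𝕜 E} {w : Seminorm 𝕜 W}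
    (S : Seminorm 𝕜 (E ⊗[𝕜] W)) {c : ℝ} (hS : ∀ x v, S (x ⊗ₜ v) ≤ c * (s x * w v))
    (hc : 0 ≤ c) (z : E ⊗[𝕜] W) : S z ≤ c * projSeminorm s w z := by
  have key : ∀ l : List (E × W), S (tensorSum 𝕜 l) ≤ c * costSum s w l := by
    intro l
    induction l with
    | nil => simp [tensorSum, costSum]
    | cons a l ih =>
      have h1 : tensorSum 𝕜 (a :: l) = a.1 ⊗ₜ[𝕜] a.2 + tensorSum 𝕜 l := by simp [tensorSum]
      have h2 : costSum s w (a :: l) = s a.1 * w a.2 + costSum s w l := by simp [costSum]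
      rw [h1, h2, mul_add]
      exact (map_add_le_add S _ _).trans (add_le_add (hS _ _) ih)
  rcases hc.eq_or_lt with rfl | hc
  · obtain ⟨l, rfl⟩ := exists_tensorSum_eq z
    simpa using key l
  · rw [← div_le_iff₀' hc]
    refine le_projSeminorm _ _ _ fun l hl => ?_
    rw [div_le_iff₀' hc, ← hl]
    exact key l

theorem projSeminorm_tmul_le (s : Seminorm 𝕜 E) (w : Seminorm 𝕜 W) (x : E) (v : W) :
    projSeminorm s w (x ⊗ₜ v) ≤ s x * w v := by
  simpa [tensorSum, costSum] using projSeminorm_le s w [(x, v)]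

theorem exists_costSum_lt_of_projSeminorm_lt {s : Seminorm 𝕜 E} {w : Seminorm 𝕜 W}
    {z : E ⊗[𝕜] W} {c : ℝ} (h : projSeminorm s w z < c) :
    ∃ l : List (E × W), tensorSum 𝕜 l = z ∧ costSum s w l < c := by
  by_contra! hc
  exact h.not_ge (le_projSeminorm s w z hc)

variable [TopologicalSpace E] [TopologicalSpace W]

variable (𝕜 E W) in
/-- The canonical map `E ⊗ W → E ⊗̂ W`, as a continuous linear map. -/
noncomputable def toCompletedTensor : ProjTensor 𝕜 E W →L[𝕜] CompletedTensor 𝕜 E W where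
  toFun z := (z : CompletedTensor 𝕜 E W)
  map_add' := Completion.coe_add
  map_smul' := Completion.coe_smul
  cont := Completion.continuous_coe _

variable (𝕜 E W) in
/-- The continuous seminorms on `E ⊗̂ W` obtained by extending the `s ⊗ w`. -/
noncomputable def projHat
    (a : {p : Seminorm 𝕜 E // Continuous p} × {q : Seminorm 𝕜 W // Continuous q}) :
    Seminorm 𝕜 (CompletedTensor 𝕜 E W) :=
  completionSeminorm ⟨projFamily 𝕜 E W a, (withSeminorms_projFamily 𝕜 E W).continuous_seminorm a⟩

variable (a : {p : Seminorm 𝕜 E // Continuous p} × {q : Seminorm 𝕜 W // Continuous q})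

theorem continuous_projHat : Continuous (projHat 𝕜 E W a) := continuous_completionSeminorm _

theorem projHat_coe (z : ProjTensor 𝕜 E W) :
    projHat 𝕜 E W a (z : CompletedTensor 𝕜 E W) = projSeminorm a.1.1 a.2.1 z :=
  completionSeminorm_coe _ z

theorem projHat_tmul_le (x : E) (v : W) : projHat 𝕜 E W a (tmul 𝕜 x v) ≤ a.1.1 x * a.2.1 v :=
  (projHat_coe a _).trans_le (projSeminorm_tmul_le a.1.1 a.2.1 x v)

variable {a} in
theorem le_projHat_of_tmul_le {S : Seminorm 𝕜 (CompletedTensor 𝕜 E W)} (hSc : Continuous S)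
    {c : ℝ} (hc : 0 ≤ c) (hS : ∀ x v, S (tmul 𝕜 x v) ≤ c * (a.1.1 x * a.2.1 v))
    (z : CompletedTensor 𝕜 E W) : S z ≤ c * projHat 𝕜 E W a z := by
  induction z using Completion.induction_on with
  | hp => exact isClosed_le hSc ((continuous_projHat a).const_mul c)
  | ih z =>
    rw [projHat_coe]
    let T : E ⊗[𝕜] W →ₗ[𝕜] CompletedTensor 𝕜 E W :=
      (toCompletedTensor 𝕜 E W).toLinearMap
    exact le_projSeminorm_of_tmul_le (S.comp T) hS hc z

variable (𝕜 E W) in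
theorem exists_finset_sup_projFamily_le
    (s : Finset ({p : Seminorm 𝕜 E // Continuous p} × {q : Seminorm 𝕜 W // Continuous q})) :
    ∃ a, s.sup (projFamily 𝕜 E W) ≤ projFamily 𝕜 E W a := by
  classical
  induction s using Finset.induction_on with
  | empty => exact ⟨(⟨0, continuous_const⟩, ⟨0, continuous_const⟩), by simp⟩
  | insert b s _ ih =>
    obtain ⟨a, ha⟩ := ih
    refine ⟨(⟨b.1.1 ⊔ a.1.1, b.1.2.sup a.1.2⟩, ⟨b.2.1 ⊔ a.2.1, b.2.2.sup a.2.2⟩), ?_⟩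
    rw [Finset.sup_insert]
    exact sup_le (projSeminorm_mono le_sup_left le_sup_left)
      (ha.trans (projSeminorm_mono le_sup_right le_sup_right))

/-- The family of the seminorms `s ⊗ w` is directed and absorbs constants, so that each continuous
seminorm is bounded by a single member of it. -/
theorem exists_le_projFamily (S : Seminorm 𝕜 (ProjTensor 𝕜 E W)) (hS : Continuous S) :
    ∃ a, S ≤ projFamily 𝕜 E W a := by
  obtain ⟨s, C, -, hC⟩ := Seminorm.bound_of_continuous (withSeminorms_projFamily 𝕜 E W) S hS
  obtain ⟨a, ha⟩ := exists_finset_sup_projFamily_le 𝕜 E W s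
  refine ⟨(⟨C • a.1.1, a.1.2.const_smul C⟩, a.2), fun z => ?_⟩
  refine (hC z).trans ((mul_le_mul_of_nonneg_left (ha z) C.2).trans ?_)
  refine le_projSeminorm _ _ _ fun l hl => ?_
  rw [show costSum (C • a.1.1) a.2.1 l = (C : ℝ) * costSum a.1.1 a.2.1 l by
    simp [costSum, List.sum_map_mul_left, mul_assoc, NNReal.smul_def]]
  rw [← hl]
  exact mul_le_mul_of_nonneg_left (projSeminorm_le a.1.1 a.2.1 l) C.2

theorem exists_le_projHat (S : Seminorm 𝕜 (CompletedTensor 𝕜 E W)) (hS : Continuous S) :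
    ∃ a, S ≤ projHat 𝕜 E W a := by
  obtain ⟨a, ha⟩ := exists_le_projFamily (S.comp (toCompletedTensor 𝕜 E W).toLinearMap)
    (hS.comp (toCompletedTensor 𝕜 E W).continuous)
  refine ⟨a, fun z => ?_⟩
  refine (le_projHat_of_tmul_le (a := a) hS zero_le_one (fun x v => ?_) z).trans (one_mul _).le
  rw [one_mul]
  exact (ha (x ⊗ₜ[𝕜] v : E ⊗[𝕜] W)).trans (projSeminorm_tmul_le _ _ x v)

end ProjHat

/-! ### Approximately liftable maps -/

section ApproxLiftable

variable {𝕜 : Type u₁} [RCLike 𝕜]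
variable {X : Type u₂} [AddCommGroup X] [Module 𝕜 X] [TopologicalSpace X]
variable {Y : Type u₃} [AddCommGroup Y] [Module 𝕜 Y] [TopologicalSpace Y]

/-- The identity of `Y` can be approximated by maps that factor through `π`, with bounds that make
an iteration converge: given `s` on `X`, there is a `t` on `Y` such that for each `u` on `Y`
there are operators `B₁, B₂ : Y → X` for which `π ∘ (B₁ + B₂)` is arbitrarily close to the identity
with respect to `u`, where `s ∘ B₁ ≤ t`, and `s ∘ B₂` is arbitrarily small.

The bound `t` for the main part `B₁` depends on `s` only, not on the seminorm `u` that measures the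
error. The two operators are kept apart because the bound for `B₁ + B₂` by the sum `t + η t'` would
not pass to tensor products: `(t + η t') ⊗ w` can exceed `t ⊗ w + η (t' ⊗ w)`. -/
def ApproxLiftable (π : X →L[𝕜] Y) : Prop :=
  ∀ s : Seminorm 𝕜 X, Continuous s → ∃ t : Seminorm 𝕜 Y, Continuous t ∧
    ∀ u : Seminorm 𝕜 Y, Continuous u → ∃ t' : Seminorm 𝕜 Y, Continuous t' ∧
      ∀ η : ℝ, 0 < η → ∃ B₁ B₂ : Y →L[𝕜] X, (∀ y, s (B₁ y) ≤ t y) ∧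
        (∀ y, s (B₂ y) ≤ η * t' y) ∧ ∀ y, u (y - π (B₁ y) - π (B₂ y)) ≤ η * t' y

/-- Tensor the operators `B₁` and `B₂` with the identity of `W`. -/
theorem ApproxLiftable.tensorMap {π : X →L[𝕜] Y} (h : ApproxLiftable π) (W : Type v)
    [AddCommGroup W] [Module 𝕜 W] [TopologicalSpace W] :
    ApproxLiftable (tensorMap π W) := by
  have hB : ∀ (B : Y →L[𝕜] X) (s : {p : Seminorm 𝕜 X // Continuous p})
      (t : {p : Seminorm 𝕜 Y // Continuous p}) (w w' : {p : Seminorm 𝕜 W // Continuous p})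
      (c : ℝ), 0 ≤ c → (∀ y, s.1 (B y) ≤ c * t.1 y) → w.1 ≤ w'.1 →
      ∀ z, projHat 𝕜 X W (s, w) (FrechetExt.tensorMap B W z) ≤ c * projHat 𝕜 Y W (t, w') z := by
    intro B s t w w' c hc hB hw z
    refine le_projHat_of_tmul_le (a := (t, w'))
      (S := (projHat 𝕜 X W (s, w)).comp (FrechetExt.tensorMap B W).toLinearMap)
      ((continuous_projHat _).comp (FrechetExt.tensorMap B W).continuous) hc (fun y v => ?_) z
    change projHat 𝕜 X W (s, w) (FrechetExt.tensorMap B W (tmul 𝕜 y v)) ≤ _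
    rw [tensorMap_tmul, ← mul_assoc]
    exact (projHat_tmul_le _ _ _).trans (mul_le_mul (hB y) (hw v) (apply_nonneg _ _)
      ((apply_nonneg _ _).trans (hB y)))
  intro S hS
  obtain ⟨⟨s, w⟩, hsw⟩ := exists_le_projHat S hS
  obtain ⟨t, ht, h⟩ := h s.1 s.2
  refine ⟨projHat 𝕜 Y W (⟨t, ht⟩, w), continuous_projHat _, fun U hU => ?_⟩
  obtain ⟨⟨u, w'⟩, huw⟩ := exists_le_projHat U hU
  obtain ⟨t', ht', h⟩ := h u.1 u.2
  refine ⟨projHat 𝕜 Y W (⟨t', ht'⟩, ⟨w.1 ⊔ w'.1, w.2.sup w'.2⟩), continuous_projHat _,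
    fun η hη => ?_⟩
  obtain ⟨B₁, B₂, h₁, h₂, h₃⟩ := h η hη
  refine ⟨FrechetExt.tensorMap B₁ W, FrechetExt.tensorMap B₂ W, fun z => ?_, fun z => ?_,
    fun z => ?_⟩
  · refine (hsw _).trans ?_
    simpa using hB B₁ s ⟨t, ht⟩ w w 1 zero_le_one (by simpa using h₁) le_rfl z
  · exact (hsw _).trans (hB B₂ s ⟨t', ht'⟩ w _ η hη.le h₂ le_sup_left z)
  · refine (huw _).trans ?_
    let D : CompletedTensor 𝕜 Y W →L[𝕜] CompletedTensor 𝕜 Y W :=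
      ContinuousLinearMap.id 𝕜 _ - (FrechetExt.tensorMap π W).comp (FrechetExt.tensorMap B₁ W) -
        (FrechetExt.tensorMap π W).comp (FrechetExt.tensorMap B₂ W)
    refine le_projHat_of_tmul_le (S := (projHat 𝕜 Y W (u, w')).comp D.toLinearMap)
      ((continuous_projHat _).comp D.continuous) hη.le (fun y v => ?_) z
    have hD : D (tmul 𝕜 y v) = tmul 𝕜 (y - π (B₁ y) - π (B₂ y)) v := by
      have hsub : ∀ y₁ y₂ : Y, (tmul 𝕜 (y₁ - y₂) v : CompletedTensor 𝕜 Y W) =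
          tmul 𝕜 y₁ v - tmul 𝕜 y₂ v := fun y₁ y₂ => by
        have : ((y₁ - y₂) ⊗ₜ[𝕜] v : Y ⊗[𝕜] W) = y₁ ⊗ₜ[𝕜] v - y₂ ⊗ₜ[𝕜] v :=
          TensorProduct.sub_tmul _ _ _
        unfold tmul
        rw [this]
        exact Completion.coe_sub (α := ProjTensor 𝕜 Y W) _ _
      simp [D, tensorMap_tmul, hsub]
    change projHat 𝕜 Y W (u, w') (D (tmul 𝕜 y v)) ≤ _
    rw [hD, ← mul_assoc]
    exact (projHat_tmul_le _ _ _).trans (mul_le_mul (h₃ y) (le_max_right _ _)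
      (apply_nonneg _ _) ((apply_nonneg _ _).trans (h₃ y)))

end ApproxLiftable

/-! ### Finite rank approximation in nuclear spaces -/

section LocalBanachMap

variable {𝕜 : Type u₁} [RCLike 𝕜]
variable {E : Type u₂} [AddCommGroup E] [Module 𝕜 E]

/-- The canonical linear map `E → Ê_q`. -/
def toLocalₗ (q : Seminorm 𝕜 E) : E →ₗ[𝕜] LocalBanach q where
  toFun x := Completion.coe' (α := SeminormedBy q) x
  map_add' x y := Completion.coe_add (α := SeminormedBy q) x y
  map_smul' c x := Completion.coe_smul (X := SeminormedBy q) c x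

theorem norm_toLocalₗ (q : Seminorm 𝕜 E) (x : E) : ‖toLocalₗ q x‖ = q x :=
  Completion.norm_coe (E := SeminormedBy q) x

theorem denseRange_toLocalₗ (q : Seminorm 𝕜 E) : DenseRange (toLocalₗ q) :=
  Completion.denseRange_coe (α := SeminormedBy q)

theorem localMap_toLocalₗ {p q : Seminorm 𝕜 E} (h : p ≤ q) (x : E) :
    localMap h (toLocalₗ q x) = toLocalₗ p x :=
  ContinuousLinearMap.completion_apply_coe (seminormedByMap h) x

/-- The canonical map `E → Ê_q` for a continuous seminorm `q`. -/
def toLocal [TopologicalSpace E] [IsTopologicalAddGroup E] (q : Seminorm 𝕜 E) (hq : Continuous q) :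
    E →L[𝕜] LocalBanach q where
  toLinearMap := toLocalₗ q
  cont := by
    refine continuous_of_continuousAt_zero (toLocalₗ q) ?_
    rw [ContinuousAt, map_zero, tendsto_zero_iff_norm_tendsto_zero]
    simp only [norm_toLocalₗ]
    exact hq.tendsto' 0 0 (map_zero q)

end LocalBanachMap

section Nuclear

variable {𝕜 : Type u₁} [RCLike 𝕜]
variable {Q : Type u₃} [AddCommGroup Q] [Module 𝕜 Q] [TopologicalSpace Q]

/-- On a nuclear space the identity is approximated with respect to a seminorm `q` by operators
`∑ φₙ ⊗ yₙ` of finite rank, with `yₙ` in the space itself rather than its completion. Both the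
error and the bound `1` for the nuclear norm refer to one seminorm `t` that does not depend on
the accuracy `ε`. -/
theorem IsNuclearSpace.exists_finiteRank_approx [IsTopologicalAddGroup Q]
    (hQ : IsNuclearSpace 𝕜 Q) (q : Seminorm 𝕜 Q)
    (hq : Continuous q) :
    ∃ t : Seminorm 𝕜 Q, Continuous t ∧ ∀ ε : ℝ, 0 < ε →
      ∃ (N : ℕ) (φ : ℕ → Q →L[𝕜] 𝕜) (y : ℕ → Q) (c : ℕ → ℝ), (∀ n, 0 ≤ c n) ∧
        (∀ n z, ‖φ n z‖ ≤ c n * t z) ∧ ∑ n ∈ Finset.range N, c n * q (y n) ≤ 1 ∧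
        ∀ z, q (z - ∑ n ∈ Finset.range N, φ n z • y n) ≤ ε * t z := by
  obtain ⟨q', hq', hle, f, e, hsum, hT⟩ := hQ q hq
  set C : ℝ := ∑' n, ‖f n‖ * ‖e n‖ with hC
  have hC0 : 0 ≤ C := tsum_nonneg fun n => by positivity
  refine ⟨Real.toNNReal (C + 1) • q', hq'.const_smul _, fun ε hε => ?_⟩
  have ht : ∀ z, (Real.toNNReal (C + 1) • q') z = (C + 1) * q' z := fun z => by
    change (Real.toNNReal (C + 1) : ℝ) * q' z = _
    rw [Real.coe_toNNReal _ (by positivity)]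
  obtain ⟨N, hN⟩ : ∃ N, ∑' n, ‖f (n + N)‖ * ‖e (n + N)‖ < ε / 2 :=
    ((tendsto_sum_nat_add fun n => ‖f n‖ * ‖e n‖).eventually
      (gt_mem_nhds (half_pos hε))).exists
  set F : ℝ := ∑ n ∈ Finset.range N, ‖f n‖ with hF
  have hF0 : 0 ≤ F := Finset.sum_nonneg fun n _ => norm_nonneg _
  -- Replacing `eₙ` by elements of `Q` at distance `δ` changes the operator by at most `F δ` in
  -- nuclear norm; the bounds `ε / 2` and `1` serve the error and the cost, respectively.
  set δ : ℝ := min (ε / 2) 1 / (F + 1) with hδ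
  have hδ0 : 0 < δ := by positivity
  have hFδ : F * δ ≤ min (ε / 2) 1 := by
    rw [hδ, mul_div_assoc', div_le_iff₀ (by positivity), mul_comm]
    gcongr
    linarith
  have hy : ∀ n, ∃ y : Q, ‖e n - toLocalₗ q y‖ < δ := fun n => by
    obtain ⟨y, hy⟩ := (denseRange_toLocalₗ q).exists_dist_lt (e n) hδ0
    exact ⟨y, by rwa [← dist_eq_norm]⟩
  choose y hy using hy
  refine ⟨N, fun n => (f n).comp (toLocal q' hq'), y, fun n => ‖f n‖ / (C + 1),
    fun n => by positivity, fun n z => ?_, ?_, fun z => ?_⟩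
  · rw [ht, ← mul_assoc, div_mul_cancel₀ _ (by positivity), ← norm_toLocalₗ]
    exact (f n).le_opNorm _
  · have h1 : ∀ n, q (y n) ≤ ‖e n‖ + δ := fun n => by
      rw [← norm_toLocalₗ]
      calc ‖toLocalₗ q (y n)‖ = ‖e n - (e n - toLocalₗ q (y n))‖ := by rw [sub_sub_cancel]
        _ ≤ _ := (norm_sub_le _ _).trans (by gcongr; exact (hy n).le)
    calc ∑ n ∈ Finset.range N, ‖f n‖ / (C + 1) * q (y n)
        ≤ ∑ n ∈ Finset.range N, ‖f n‖ / (C + 1) * (‖e n‖ + δ) := by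
          gcongr with n _
          exact h1 n
      _ = (∑ n ∈ Finset.range N, ‖f n‖ * ‖e n‖ + F * δ) / (C + 1) := by
          rw [hF, Finset.sum_mul, ← Finset.sum_add_distrib, Finset.sum_div]
          exact Finset.sum_congr rfl fun n _ => by ring
      _ ≤ (C + 1) / (C + 1) := by
          gcongr
          · exact hsum.sum_le_tsum _ fun n _ => by positivity
          · exact hFδ.trans (min_le_right _ _)
      _ = 1 := div_self (by positivity)
  · set x := toLocalₗ q' z with hx
    have hxn : ‖x‖ = q' z := norm_toLocalₗ q' z
    have hTx : localMap hle x = toLocalₗ q z := localMap_toLocalₗ hle z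
    have hsx : Summable fun n => ‖f n x • e n‖ := by
      refine Summable.of_nonneg_of_le (fun n => norm_nonneg _) (fun n => ?_)
        (hsum.mul_right ‖x‖)
      rw [norm_smul, mul_right_comm]
      gcongr
      exact (f n).le_opNorm _
    have htail : ‖∑' n, f (n + N) x • e (n + N)‖ ≤ ε / 2 * ‖x‖ := by
      have hs1 := (summable_nat_add_iff N).2 hsx
      have hs2 := (summable_nat_add_iff N).2 hsum
      refine (norm_tsum_le_tsum_norm hs1).trans ?_
      refine le_trans ?_ (mul_le_mul_of_nonneg_right hN.le (norm_nonneg x))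
      rw [← tsum_mul_right]
      refine hs1.tsum_le_tsum (fun n => ?_) (hs2.mul_right _)
      rw [norm_smul, mul_right_comm]
      gcongr
      exact (f _).le_opNorm _
    have heq : toLocalₗ q (z - ∑ n ∈ Finset.range N, f n x • y n) =
        ∑' n, f (n + N) x • e (n + N) +
          ∑ n ∈ Finset.range N, f n x • (e n - toLocalₗ q (y n)) := by
      have h := hsx.of_norm.sum_add_tsum_nat_add N
      rw [(hT x).tsum_eq, hTx] at h
      rw [map_sub, map_sum, ← h]
      simp only [map_smul, smul_sub, Finset.sum_sub_distrib]
      abel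
    have hhead : ‖∑ n ∈ Finset.range N, f n x • (e n - toLocalₗ q (y n))‖ ≤ ε / 2 * ‖x‖ := by
      calc _ ≤ ∑ n ∈ Finset.range N, ‖f n‖ * ‖x‖ * δ := by
            refine norm_sum_le_of_le _ fun n _ => ?_
            rw [norm_smul]
            gcongr
            · exact (f n).le_opNorm _
            · exact (hy n).le
        _ = F * δ * ‖x‖ := by
            rw [hF, Finset.sum_mul, Finset.sum_mul]
            exact Finset.sum_congr rfl fun n _ => by ring
        _ ≤ _ := by
            gcongr
            exact hFδ.trans (min_le_left _ _)
    rw [ht]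
    calc q (z - ∑ n ∈ Finset.range N, f n x • y n)
        = ‖toLocalₗ q (z - ∑ n ∈ Finset.range N, f n x • y n)‖ := (norm_toLocalₗ _ _).symm
      _ ≤ ε / 2 * ‖x‖ + ε / 2 * ‖x‖ := by
          rw [heq]
          exact (norm_add_le _ _).trans (add_le_add htail hhead)
      _ = ε * (1 * q' z) := by rw [hxn]; ring
      _ ≤ ε * ((C + 1) * q' z) := by
          gcongr
          linarith

variable {E : Type u₂} [AddCommGroup E] [Module 𝕜 E] [TopologicalSpace E]
  [IsTopologicalAddGroup E] [ContinuousSMul 𝕜 E]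

/-- An operator of finite rank on `Q` lifts to an operator `Q → E`, with a bound for the lift by
the nuclear norm with respect to the quotient seminorm. -/
theorem exists_finiteRank_lift (p : E →L[𝕜] Q) (hp : Function.Surjective p) (s : Seminorm 𝕜 E)
    {t : Seminorm 𝕜 Q} {N : ℕ} {φ : ℕ → Q →L[𝕜] 𝕜} {y : ℕ → Q} {c : ℕ → ℝ} (hc : ∀ n, 0 ≤ c n)
    (hφ : ∀ n z, ‖φ n z‖ ≤ c n * t z) {C : ℝ}
    (hC : ∑ n ∈ Finset.range N, c n * quotSeminorm (p : E →ₗ[𝕜] Q) hp s (y n) < C) :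
    ∃ B : Q →L[𝕜] E, (∀ z, p (B z) = ∑ n ∈ Finset.range N, φ n z • y n) ∧
      ∀ z, s (B z) ≤ C * t z := by
  set q := quotSeminorm (p : E →ₗ[𝕜] Q) hp s with hq
  set S : ℝ := ∑ n ∈ Finset.range N, c n with hS
  have hS0 : 0 ≤ S := Finset.sum_nonneg fun n _ => hc n
  set δ : ℝ := (C - ∑ n ∈ Finset.range N, c n * q (y n)) / (S + 1) with hδ
  have hδ0 : 0 < δ := div_pos (sub_pos.2 hC) (by positivity)
  have he : ∀ n, ∃ e, p e = y n ∧ s e < q (y n) + δ := fun n =>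
    exists_lift_lt_of_quotSeminorm_lt (p : E →ₗ[𝕜] Q) hp s (lt_add_of_pos_right _ hδ0)
  choose e hpe hse using he
  refine ⟨∑ n ∈ Finset.range N, (φ n).smulRight (e n), fun z => ?_, fun z => ?_⟩
  · simp [map_sum, hpe]
  · have hδS : S * δ ≤ C - ∑ n ∈ Finset.range N, c n * q (y n) := by
      rw [hδ, mul_div_assoc', div_le_iff₀ (by positivity), mul_comm]
      exact mul_le_mul_of_nonneg_left (by linarith) (sub_pos.2 hC).le
    calc s ((∑ n ∈ Finset.range N, (φ n).smulRight (e n)) z)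
        ≤ ∑ n ∈ Finset.range N, s (φ n z • e n) := by
          rw [sum_apply]
          exact Finset.le_sum_of_subadditive s (map_zero s).le (map_add_le_add s) _ _
      _ ≤ ∑ n ∈ Finset.range N, c n * t z * (q (y n) + δ) := by
          gcongr with n _
          rw [map_smul_eq_mul]
          gcongr
          · exact mul_nonneg (hc n) (apply_nonneg t z)
          · exact hφ n z
          · exact (hse n).le
      _ = (∑ n ∈ Finset.range N, c n * q (y n) + S * δ) * t z := by
          rw [hS, Finset.sum_mul, ← Finset.sum_add_distrib, Finset.sum_mul]
          exact Finset.sum_congr rfl fun n _ => by ring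
      _ ≤ C * t z := by
          gcongr
          linarith

/-- Let `R` and `R'` be approximations of the identity of finite rank, `R` with respect to the
quotient seminorm `q` of `s`, and `R'` with respect to `u ⊔ t`. Then `B₁` lifts `R` and `B₂` lifts
`(1 - R) ∘ R'`, which has small nuclear norm because `1 - R` is small from `t` to `q`, and the
remaining error is `(1 - R) ∘ (1 - R')`. -/
theorem IsNuclearSpace.approxLiftable [IsTopologicalAddGroup Q] [ContinuousSMul 𝕜 Q]
    (hQ : IsNuclearSpace 𝕜 Q) (p : E →L[𝕜] Q)
    (hp : Function.Surjective p) (ho : IsOpenMap p) : ApproxLiftable p := by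
  intro s hs
  set q := quotSeminorm (p : E →ₗ[𝕜] Q) hp s with hq
  have hqc : Continuous q := continuous_quotSeminorm (p : E →ₗ[𝕜] Q) hp s ho hs
  obtain ⟨t, ht, hN⟩ := hQ.exists_finiteRank_approx q hqc
  refine ⟨(2 : NNReal) • t, ht.const_smul _, fun u hu => ?_⟩
  obtain ⟨t', ht', hN'⟩ := hQ.exists_finiteRank_approx (u ⊔ t) (hu.sup ht)
  refine ⟨t', ht', fun η hη => ?_⟩
  obtain ⟨N, φ, y, c, hc, hφ, hcost, happ⟩ := hN (η / 2) (half_pos hη)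
  set K : ℝ := ∑ n ∈ Finset.range N, c n * u (y n) with hK
  have hK0 : 0 ≤ K := Finset.sum_nonneg fun n _ => mul_nonneg (hc n) (apply_nonneg _ _)
  set R : Q →L[𝕜] Q := ∑ n ∈ Finset.range N, (φ n).smulRight (y n) with hR
  have hRz : ∀ z, R z = ∑ n ∈ Finset.range N, φ n z • y n := fun z => by
    simp [hR]
  have huR : ∀ z, u (R z) ≤ K * t z := fun z => by
    rw [hRz, hK, Finset.sum_mul]
    refine (Finset.le_sum_of_subadditive u (map_zero u).le (map_add_le_add u) _ _).trans ?_
    refine Finset.sum_le_sum fun n _ => ?_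
    rw [map_smul_eq_mul, mul_right_comm]
    exact mul_le_mul_of_nonneg_right (hφ n z) (apply_nonneg _ _)
  -- The accuracy of `R'` is chosen after `R`, to compensate for the norm `K` of `R` from `t` to `u`.
  obtain ⟨N', φ', y', c', hc', hφ', hcost', happ'⟩ := hN' (η / (1 + K)) (by positivity)
  obtain ⟨B₁, hpB₁, hB₁⟩ := exists_finiteRank_lift p hp s hc hφ (C := 2)
    (hcost.trans_lt one_lt_two)
  have hcost₂ : ∑ n ∈ Finset.range N', c' n * q (y' n - R (y' n)) < η := by
    calc ∑ n ∈ Finset.range N', c' n * q (y' n - R (y' n))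
        ≤ ∑ n ∈ Finset.range N', c' n * (η / 2 * (u ⊔ t) (y' n)) := by
          refine Finset.sum_le_sum fun n _ => mul_le_mul_of_nonneg_left ?_ (hc' n)
          rw [hRz]
          refine (happ _).trans (mul_le_mul_of_nonneg_left ?_ (half_pos hη).le)
          exact le_max_right (u (y' n)) (t (y' n))
      _ = η / 2 * ∑ n ∈ Finset.range N', c' n * (u ⊔ t) (y' n) := by
          rw [Finset.mul_sum]
          exact Finset.sum_congr rfl fun n _ => by ring
      _ ≤ η / 2 * 1 := by gcongr
      _ < η := by linarith
  obtain ⟨B₂, hpB₂, hB₂⟩ := exists_finiteRank_lift p hp s hc' hφ' hcost₂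
  refine ⟨B₁, B₂, hB₁, hB₂, fun z => ?_⟩
  set r := z - ∑ n ∈ Finset.range N', φ' n z • y' n with hr
  have heq : z - p (B₁ z) - p (B₂ z) = r - R r := by
    rw [hpB₁, ← hRz, hpB₂, hr, map_sub, map_sum]
    simp only [map_smul, smul_sub, Finset.sum_sub_distrib]
    abel
  rw [heq]
  have h1 : u r ≤ (u ⊔ t) r := le_max_left (u r) (t r)
  have h2 : t r ≤ (u ⊔ t) r := le_max_right (u r) (t r)
  calc u (r - R r) ≤ u r + u (R r) := map_sub_le_add u _ _
    _ ≤ (u ⊔ t) r + K * (u ⊔ t) r := by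
        refine add_le_add h1 ((huR r).trans ?_)
        gcongr
    _ = (1 + K) * (u ⊔ t) r := by ring
    _ ≤ (1 + K) * (η / (1 + K) * t' z) := by
        gcongr
        exact happ' z
    _ = η * t' z := by field_simp

end Nuclear

/-! ### Lifting maps from Banach spaces -/

section Lift

variable {𝕜 : Type u₁} [RCLike 𝕜]

theorem exists_monotone_seq_seminorm (𝕜 : Type u₁) [RCLike 𝕜] (E : Type u₂) [AddCommGroup E]
    [Module 𝕜 E] [TopologicalSpace E] [PolynormableSpace 𝕜 E] [FirstCountableTopology E] :
    ∃ S : ℕ → Seminorm 𝕜 E, Monotone S ∧ (∀ n, Continuous (S n)) ∧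
      ∀ p : Seminorm 𝕜 E, Continuous p → ∃ n, p ≤ S n := by
  obtain ⟨P, hP⟩ := exists_seq_seminorm 𝕜 E
  let S : ℕ → {p : Seminorm 𝕜 E // Continuous p} := fun n =>
    Nat.rec (P 0) (fun n s => ⟨s.1 ⊔ (P (n + 1)).1, s.2.sup (P (n + 1)).2⟩) n
  have hPS : ∀ n, (P n).1 ≤ (S n).1 := fun n => by
    cases n with
    | zero => exact le_rfl
    | succ n => exact le_sup_right (a := (S n).1)
  refine ⟨fun n => (S n).1, monotone_nat_of_le_succ fun n => le_sup_left, fun n => (S n).2,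
    fun p hp => ?_⟩
  obtain ⟨n, hn⟩ := hP p hp
  exact ⟨n, hn.trans (hPS n)⟩

theorem exists_seminorm_ball_subset {E : Type u₂} [AddCommGroup E] [Module 𝕜 E]
    [TopologicalSpace E] [PolynormableSpace 𝕜 E] {U : Set E} (hU : U ∈ 𝓝 0) :
    ∃ p : Seminorm 𝕜 E, Continuous p ∧ p.ball 0 1 ⊆ U := by
  have hE := PolynormableSpace.withSeminorms 𝕜 E
  have := hE.topologicalAddGroup
  have := hE.continuousSMul
  obtain ⟨s, r, hr, hs⟩ := (hE.mem_nhds_iff 0 U).1 hU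
  set t : Seminorm 𝕜 E := s.sup fun p : {p : Seminorm 𝕜 E // Continuous p} => p.1 with ht
  have htc : Continuous t :=
    Seminorm.continuous (r := 1) ((hE.mem_nhds_iff 0 _).2 ⟨s, 1, one_pos, le_rfl⟩)
  refine ⟨Real.toNNReal r⁻¹ • t, htc.const_smul _, fun x hx => hs ?_⟩
  rw [Seminorm.mem_ball_zero] at hx ⊢
  have hx' : (Real.toNNReal r⁻¹ : ℝ) * t x < 1 := hx
  rw [Real.coe_toNNReal _ (inv_pos.2 hr).le] at hx'
  rwa [inv_mul_lt_iff₀ hr, mul_one] at hx'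

theorem summable_of_seminorm_le {X : Type u₂} [AddCommGroup X] [Module 𝕜 X] [UniformSpace X]
    [IsUniformAddGroup X] [PolynormableSpace 𝕜 X] [CompleteSpace X] {f : ℕ → X} {b : ℕ → ℝ}
    (hb : Summable b)
    (h : ∀ p : Seminorm 𝕜 X, Continuous p → ∃ m, ∀ k, m ≤ k → p (f k) ≤ b k) : Summable f := by
  rw [summable_iff_vanishing]
  intro e he
  obtain ⟨p, hpc, hpe⟩ := exists_seminorm_ball_subset (𝕜 := 𝕜) he
  obtain ⟨m, hm⟩ := h p hpc
  obtain ⟨s, hs⟩ := summable_iff_vanishing.1 hb (Set.Iio 1) (Iio_mem_nhds one_pos)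
  refine ⟨s ∪ Finset.range m, fun t ht => hpe ?_⟩
  rw [Finset.disjoint_union_right] at ht
  rw [Seminorm.mem_ball_zero]
  refine lt_of_le_of_lt ?_ (hs t ht.1)
  refine (Finset.le_sum_of_subadditive p (map_zero p).le (map_add_le_add p) _ _).trans ?_
  refine Finset.sum_le_sum fun k hk => hm k ?_
  by_contra! hlt
  exact Finset.disjoint_left.1 ht.2 hk (Finset.mem_range.2 hlt)

/-- A series of continuous linear maps from a normed space converges pointwise to a continuous linear
map if each continuous seminorm of its terms is eventually bounded by the terms of one summable
series. -/
theorem exists_hasSum_clm {X : Type u₂} [AddCommGroup X] [Module 𝕜 X] [UniformSpace X]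
    [IsUniformAddGroup X] [PolynormableSpace 𝕜 X] [CompleteSpace X] [T2Space X]
    {V : Type w} [NormedAddCommGroup V] [NormedSpace 𝕜 V] {g : ℕ → V →L[𝕜] X} {b : ℕ → ℝ}
    (hb : Summable b) (hb0 : ∀ k, 0 ≤ b k)
    (h : ∀ p : Seminorm 𝕜 X, Continuous p → ∃ m, ∀ k, m ≤ k → ∀ v, p (g k v) ≤ b k * ‖v‖) :
    ∃ G : V →L[𝕜] X, ∀ v, HasSum (fun k => g k v) (G v) := by
  have := (PolynormableSpace.withSeminorms 𝕜 X).continuousSMul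
  have hsum : ∀ v, Summable fun k => g k v := fun v =>
    summable_of_seminorm_le (𝕜 := 𝕜) (hb.mul_right ‖v‖) fun p hp =>
      (h p hp).imp fun m hm k hk => hm k hk v
  let G : V →ₗ[𝕜] X :=
    { toFun := fun v => ∑' k, g k v
      map_add' := fun v v' => by
        simp only [map_add]
        exact (hsum v).tsum_add (hsum v')
      map_smul' := fun c v => by
        simp only [map_smul, RingHom.id_apply]
        exact (hsum v).tsum_const_smul c }
  refine ⟨⟨G, ?_⟩, fun v => (hsum v).hasSum⟩
  refine (PolynormableSpace.withSeminorms 𝕜 X).continuous_of_continuous_comp G fun ⟨p, hp⟩ => ?_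
  obtain ⟨m, hm⟩ := h p hp
  have hle : p.comp G ≤ p.comp (∑ k ∈ Finset.range m, g k).toLinearMap +
      Real.toNNReal (∑' k, b k) • normSeminorm 𝕜 V := by
    intro v
    change p (G v) ≤ p ((∑ k ∈ Finset.range m, g k) v) + (Real.toNNReal (∑' k, b k) : ℝ) * ‖v‖
    rw [Real.coe_toNNReal _ (tsum_nonneg hb0), sum_apply]
    refine le_of_tendsto ((hp.tendsto (G v)).comp (hsum v).hasSum.tendsto_sum_nat) ?_
    filter_upwards [Filter.eventually_ge_atTop m] with n hn
    rw [Function.comp_apply, ← Finset.sum_range_add_sum_Ico _ hn]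
    refine (map_add_le_add p _ _).trans ?_
    gcongr
    refine (Finset.le_sum_of_subadditive p (map_zero p).le (map_add_le_add p) _ _).trans ?_
    refine (Finset.sum_le_sum fun k hk => hm k (Finset.mem_Ico.1 hk).1 v).trans ?_
    rw [← Finset.sum_mul]
    gcongr
    exact hb.sum_le_tsum _ fun k _ => hb0 k
  refine Seminorm.continuous_of_le ?_ hle
  exact (hp.comp (∑ k ∈ Finset.range m, g k).continuous).add (continuous_norm.const_smul _)

/-- Successive approximation: the remainders `r₀ = f`, `rₖ₊₁ = rₖ - π ∘ gₖ` with
`gₖ = (B₁ + B₂) ∘ rₖ` tend to `0`, and `∑ gₖ` converges because the operators for step `k` are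
chosen such that the next remainder is small with respect to the seminorm `t (k + 1)` that controls
the main part of `gₖ₊₁`. -/
theorem ApproxLiftable.exists_lift {X : Type u₂} [AddCommGroup X] [Module 𝕜 X] [UniformSpace X]
    [IsUniformAddGroup X] [PolynormableSpace 𝕜 X] [CompleteSpace X] [T2Space X]
    [FirstCountableTopology X]
    {Y : Type u₃} [AddCommGroup Y] [Module 𝕜 Y] [TopologicalSpace Y] [IsTopologicalAddGroup Y]
    [PolynormableSpace 𝕜 Y] [FirstCountableTopology Y] [T2Space Y]
    {π : X →L[𝕜] Y} (h : ApproxLiftable π)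
    {V : Type w} [NormedAddCommGroup V] [NormedSpace 𝕜 V] (f : V →L[𝕜] Y) :
    ∃ g : V →L[𝕜] X, π.comp g = f := by
  obtain ⟨S, hSm, hSc, hS⟩ := exists_monotone_seq_seminorm 𝕜 X
  obtain ⟨U, hUm, hUc, hU⟩ := exists_monotone_seq_seminorm 𝕜 Y
  choose t ht h using fun k => h (S k) (hSc k)
  have hbound : ∀ (q : Seminorm 𝕜 Y), Continuous q → ∀ r : V →L[𝕜] Y,
      ∃ C, 0 < C ∧ ∀ v, q (r v) ≤ C * ‖v‖ := fun q hq r =>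
    Seminorm.bound_of_continuous_normedSpace (q.comp r.toLinearMap) (hq.comp r.continuous)
  obtain ⟨D, hD, hDf⟩ := hbound (t 0) (ht 0) f
  have step : ∀ (k : ℕ) (r : {r : V →L[𝕜] Y // ∀ v, t k (r v) ≤ D * (1 / 2) ^ k * ‖v‖}),
      ∃ g : V →L[𝕜] X, (∀ v, S k (g v) ≤ 2 * D * (1 / 2) ^ k * ‖v‖) ∧
        (∀ v, t (k + 1) ((r.1 - π.comp g) v) ≤ D * (1 / 2) ^ (k + 1) * ‖v‖) ∧
        ∀ v, U k ((r.1 - π.comp g) v) ≤ D * (1 / 2) ^ k * ‖v‖ := by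
    rintro k ⟨r, hr⟩
    obtain ⟨t', ht', h⟩ := h k (t (k + 1) ⊔ U k) ((ht _).sup (hUc k))
    -- Only continuity of `r` bounds it with respect to `t'`; a small `η` compensates for `A`.
    obtain ⟨A, hA, hAr⟩ := hbound t' ht' r
    obtain ⟨B₁, B₂, h₁, h₂, h₃⟩ := h (D * (1 / 2) ^ (k + 1) / A) (by positivity)
    have hη : ∀ v, D * (1 / 2) ^ (k + 1) / A * t' (r v) ≤ D * (1 / 2) ^ (k + 1) * ‖v‖ := by
      intro v
      calc _ ≤ D * (1 / 2) ^ (k + 1) / A * (A * ‖v‖) := by gcongr; exact hAr v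
        _ = _ := by field_simp
    have hpow : D * (1 / 2 : ℝ) ^ (k + 1) ≤ D * (1 / 2) ^ k := by
      gcongr ?_ * ?_
      exact pow_le_pow_of_le_one (by norm_num) (by norm_num) k.le_succ
    have h₃' : ∀ v, (t (k + 1) ⊔ U k) ((r - π.comp ((B₁ + B₂).comp r)) v) ≤
        D * (1 / 2) ^ (k + 1) * ‖v‖ := fun v => by
      have : (r - π.comp ((B₁ + B₂).comp r)) v = r v - π (B₁ (r v)) - π (B₂ (r v)) := by
        simp [sub_sub]
      rw [this]
      exact (h₃ _).trans (hη v)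
    refine ⟨(B₁ + B₂).comp r, fun v => ?_, fun v => ?_, fun v => ?_⟩
    · calc S k (B₁ (r v) + B₂ (r v)) ≤ S k (B₁ (r v)) + S k (B₂ (r v)) := map_add_le_add _ _ _
        _ ≤ D * (1 / 2) ^ k * ‖v‖ + D * (1 / 2) ^ (k + 1) * ‖v‖ :=
          add_le_add ((h₁ _).trans (hr v)) ((h₂ _).trans (hη v))
        _ ≤ D * (1 / 2) ^ k * ‖v‖ + D * (1 / 2) ^ k * ‖v‖ := by gcongr
        _ = _ := by ring
    · exact (le_max_left _ _).trans (h₃' v)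
    · refine ((le_max_right _ _).trans (h₃' v)).trans ?_
      gcongr
  choose g hgS hgt hgU using step
  let r : (k : ℕ) → {r : V →L[𝕜] Y // ∀ v, t k (r v) ≤ D * (1 / 2) ^ k * ‖v‖} := fun k =>
    Nat.rec ⟨f, by simpa using hDf⟩ (fun k r => ⟨r.1 - π.comp (g k r), hgt k r⟩) k
  have hr : ∀ k, (r (k + 1)).1 = (r k).1 - π.comp (g k (r k)) := fun k => rfl
  obtain ⟨G, hG⟩ := exists_hasSum_clm (g := fun k => g k (r k))
    (b := fun k => 2 * D * (1 / 2 : ℝ) ^ k) (summable_geometric_two.mul_left _)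
    (fun k => by positivity) (fun p hp => by
      obtain ⟨m, hm⟩ := hS p hp
      exact ⟨m, fun k hk v => ((hm.trans (hSm hk)) _).trans (hgS k (r k) v)⟩)
  refine ⟨G, ContinuousLinearMap.ext fun v => ?_⟩
  have hpart : ∀ n, π (∑ k ∈ Finset.range n, g k (r k) v) = f v - (r n).1 v := by
    intro n
    induction n with
    | zero => simp [r]
    | succ n ih =>
      rw [Finset.sum_range_succ, map_add, ih, hr, sub_apply, ContinuousLinearMap.comp_apply]
      abel
  have hlim : Filter.Tendsto (fun n => (r n).1 v) Filter.atTop (𝓝 0) := by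
    rw [← Filter.tendsto_add_atTop_iff_nat 1]
    refine ((PolynormableSpace.withSeminorms 𝕜 Y).tendsto_nhds _ _).2 fun ⟨p, hp⟩ ε hε => ?_
    obtain ⟨m, hm⟩ := hU p hp
    have hgeo : Filter.Tendsto (fun k : ℕ => D * (1 / 2 : ℝ) ^ k * ‖v‖) Filter.atTop (𝓝 0) := by
      have := ((tendsto_pow_atTop_nhds_zero_of_lt_one (r := (1 / 2 : ℝ)) (by norm_num)
        (by norm_num)).const_mul D).mul_const ‖v‖
      simpa using this
    filter_upwards [Filter.eventually_ge_atTop m, hgeo.eventually (gt_mem_nhds hε)] with k hk hk'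
    rw [sub_zero]
    exact ((hm.trans (hUm hk)) _).trans_lt ((hgU k (r k) v).trans_lt hk')
  have h1 := (π.continuous.tendsto (G v)).comp (hG v).tendsto_sum_nat
  have h2 : Filter.Tendsto (fun n => f v - (r n).1 v) Filter.atTop (𝓝 (f v)) := by
    simpa using hlim.const_sub (f v)
  exact tendsto_nhds_unique h1 (h2.congr fun n => (hpart n).symm)

end Lift

/-! ### Extending maps to Banach spaces -/

section LocalExtension

variable {𝕜 : Type u₁} [RCLike 𝕜]
variable {I : Type u₂} [AddCommGroup I] [Module 𝕜 I] [TopologicalSpace I]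
variable {E : Type u₃} [AddCommGroup E] [Module 𝕜 E] [TopologicalSpace E]
  [PolynormableSpace 𝕜 E]

theorem exists_le_comp_of_isInducing {i : I →L[𝕜] E} (hi : IsInducing i) (a : Seminorm 𝕜 I)
    (ha : Continuous a) : ∃ r : Seminorm 𝕜 E, Continuous r ∧ ∀ x, a x ≤ r (i x) := by
  have h := a.ball_mem_nhds ha one_pos
  rw [hi.nhds_eq_comap, map_zero] at h
  obtain ⟨U, hU, hUa⟩ := h
  obtain ⟨r, hr, hrU⟩ := exists_seminorm_ball_subset (𝕜 := 𝕜) hU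
  refine ⟨r, hr, Seminorm.le_of_ball_subset a (r.comp i.toLinearMap) fun x hx => hUa (hrU ?_)⟩
  rw [Seminorm.mem_ball_zero] at hx ⊢
  exact hx

section QuotientMap

variable {E : Type u₃} [AddCommGroup E] [Module 𝕜 E]
variable {Q : Type u₄} [AddCommGroup Q] [Module 𝕜 Q]
variable (p : E →ₗ[𝕜] Q) (hp : Function.Surjective p) (r : Seminorm 𝕜 E)

/-- A surjective linear map `p`, as a contraction `(E, r) → (Q, r')` with `r'` the quotient seminorm
of `r`. -/
noncomputable def seminormedByQuot : SeminormedBy r →L[𝕜] SeminormedBy (quotSeminorm p hp r) :=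
  LinearMap.mkContinuous (p : E →ₗ[𝕜] Q) 1 fun x =>
    (quotSeminorm_apply_le p hp r x).trans (one_mul (r x)).ge

theorem isOpenMap_seminormedByQuot : IsOpenMap (seminormedByQuot p hp r) := by
  refine (IsTopologicalAddGroup.isOpenMap_iff_nhds_zero
    (f := (seminormedByQuot p hp r : SeminormedBy r →+ SeminormedBy (quotSeminorm p hp r)))).2 ?_
  refine (Metric.nhds_basis_ball.map _).ge_iff.2 fun ε hε => ?_
  refine Filter.mem_of_superset (Metric.ball_mem_nhds _ hε) fun y hy => ?_
  rw [mem_ball_zero_iff] at hy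
  obtain ⟨x, hx, hxε⟩ := exists_lift_lt_of_quotSeminorm_lt p hp r hy
  exact ⟨x, mem_ball_zero_iff.2 hxε, hx⟩

end QuotientMap

variable [IsTopologicalAddGroup E]
variable {Q : Type u₄} [AddCommGroup Q] [Module 𝕜 Q] [TopologicalSpace Q]
  [IsTopologicalAddGroup Q] [ContinuousSMul 𝕜 Q]

/-- The universal case of the extension problem: `I → Î_a` extends to `E`. If `r` is a seminorm on
`E` with `a ≤ r ∘ i` and `q` is its quotient seminorm on `Q`, the canonical map `Q → Q̂_q` is nuclear
on some `Q̂_{q'}` and therefore lifts along `Ê_r → Q̂_q`. Subtracting the lift from `E → Ê_r` gives a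
map into the closure of `i(I)` in `Ê_r`, and `I → Î_a` extends to this closure. -/
theorem IsExtension.exists_extend_toLocal {i : I →L[𝕜] E} {p : E →L[𝕜] Q}
    (hext : IsExtension i p) (hQ : IsNuclearSpace 𝕜 Q) (a : Seminorm 𝕜 I) (ha : Continuous a) :
    ∃ κ : E →L[𝕜] LocalBanach a, ∀ x, κ (i x) = toLocalₗ a x := by
  obtain ⟨r, hr, har⟩ := exists_le_comp_of_isInducing hext.isEmbedding.isInducing a ha
  have hp := hext.surjective
  set q := quotSeminorm (p : E →ₗ[𝕜] Q) hp r with hq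
  have hqc : Continuous q := continuous_quotSeminorm (p : E →ₗ[𝕜] Q) hp r hext.isOpenMap hr
  let P : LocalBanach r →L[𝕜] LocalBanach q := (seminormedByQuot (p : E →ₗ[𝕜] Q) hp r).completion
  have hP : ∀ x, P (toLocalₗ r x) = toLocalₗ q (p x) := fun x =>
    ContinuousLinearMap.completion_apply_coe (seminormedByQuot (p : E →ₗ[𝕜] Q) hp r) x
  obtain ⟨-, hPs, hPk⟩ := completion_isOpenMap_surjective_ker
    (seminormedByQuot (p : E →ₗ[𝕜] Q) hp r) (isOpenMap_seminormedByQuot _ hp r) hp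
  obtain ⟨q', hq', hle, f, y, hsum, hT⟩ := hQ q hqc
  obtain ⟨C, hC, hlift⟩ := P.exists_preimage_norm_le hPs
  choose e hPe he using fun n => hlift (y n)
  have hsum' : Summable fun n => (f n).smulRight (e n) := by
    refine Summable.of_norm_bounded (hsum.mul_left C) fun n => ?_
    rw [ContinuousLinearMap.norm_smulRight_apply]
    calc ‖f n‖ * ‖e n‖ ≤ ‖f n‖ * (C * ‖y n‖) := by gcongr; exact he n
      _ = _ := by ring
  let σ : LocalBanach q' →L[𝕜] LocalBanach r := ∑' n, (f n).smulRight (e n)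
  have hσ : ∀ x, P (σ x) = localMap hle x := fun x => by
    have h1 : HasSum (fun n => f n x • e n) (σ x) :=
      hsum'.hasSum.mapL (ContinuousLinearMap.apply 𝕜 (LocalBanach r) x)
    have h2 := h1.mapL P
    simp only [map_smul, hPe] at h2
    exact h2.unique (hT x)
  let h : E →L[𝕜] LocalBanach r := toLocal r hr - σ.comp ((toLocal q' hq').comp p)
  have hh : ∀ x, h x = toLocalₗ r x - σ (toLocalₗ q' (p x)) := fun x => rfl
  let j : I →ₗ[𝕜] LocalBanach r := toLocalₗ r ∘ₗ (i : I →ₗ[𝕜] E)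
  let M : Submodule 𝕜 (LocalBanach r) := (LinearMap.range j).topologicalClosure
  have hhM : ∀ x, h x ∈ M := by
    intro x
    have h0 : P (h x) = 0 := by
      rw [hh, map_sub, hP, hσ, localMap_toLocalₗ, sub_self]
    refine closure_mono ?_ (hPk (h x) h0)
    rintro _ ⟨z, hz, rfl⟩
    obtain ⟨w, hw⟩ := (hext.exact z).1 hz
    exact ⟨w, congrArg (toLocalₗ r) hw⟩
  let jM : I →ₗ[𝕜] M := j.codRestrict M fun x => subset_closure ⟨x, rfl⟩
  have hjM : DenseRange jM := by
    rintro ⟨z, hz⟩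
    rw [closure_subtype]
    refine closure_mono ?_ hz
    rintro _ ⟨x, rfl⟩
    exact ⟨jM x, ⟨x, rfl⟩, rfl⟩
  have hbd : ∀ x, ‖toLocalₗ a x‖ ≤ 1 * ‖jM x‖ := fun x => by
    rw [one_mul, norm_toLocalₗ]
    exact (har x).trans (norm_toLocalₗ r (i x)).ge
  refine ⟨((toLocalₗ a).extendOfNorm jM).comp (h.codRestrict M hhM), fun x => ?_⟩
  have hx : h.codRestrict M hhM (i x) = jM x := by
    refine Subtype.ext ?_
    change h (i x) = toLocalₗ r (i x)
    have h0 : p (i x) = 0 := (hext.exact _).2 ⟨x, rfl⟩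
    rw [hh, h0, map_zero, map_zero, sub_zero]
  rw [ContinuousLinearMap.comp_apply, hx]
  exact LinearMap.extendOfNorm_eq hjM ⟨1, hbd⟩ x

theorem exists_extend_localBanach {V : Type w} [NormedAddCommGroup V] [NormedSpace 𝕜 V]
    [CompleteSpace V] {I : Type u₂} [AddCommGroup I] [Module 𝕜 I] (a : Seminorm 𝕜 I)
    (f : I →ₗ[𝕜] V) {C : ℝ} (hf : ∀ x, ‖f x‖ ≤ C * a x) :
    ∃ g : LocalBanach a →L[𝕜] V, (∀ x, g (toLocalₗ a x) = f x) ∧ ∀ z, ‖g z‖ ≤ C * ‖z‖ := by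
  have hf' : ∀ x, ‖f x‖ ≤ C * ‖toLocalₗ a x‖ := fun x => by
    rw [norm_toLocalₗ]
    exact hf x
  exact ⟨f.extendOfNorm (toLocalₗ a),
    LinearMap.extendOfNorm_eq (denseRange_toLocalₗ a) ⟨C, hf'⟩,
    LinearMap.norm_extendOfNorm_apply_le (denseRange_toLocalₗ a) C hf'⟩

/-- A bilinear map `I × W → V` bounded by `a ⊗ q` extends to `E × W`: extend the corresponding map from
`I` to the Banach space of operators `Ŵ_q → V`. -/
theorem IsExtension.exists_extend_bilinear {i : I →L[𝕜] E} {p : E →L[𝕜] Q}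
    (hext : IsExtension i p) (hQ : IsNuclearSpace 𝕜 Q)
    {W : Type v} [AddCommGroup W] [Module 𝕜 W]
    {V : Type w} [NormedAddCommGroup V] [NormedSpace 𝕜 V] [CompleteSpace V]
    (b : I ⊗[𝕜] W →ₗ[𝕜] V) (a : Seminorm 𝕜 I) (ha : Continuous a) (q : Seminorm 𝕜 W)
    (hb : ∀ x v, ‖b (x ⊗ₜ v)‖ ≤ a x * q v) :
    ∃ r : Seminorm 𝕜 E, Continuous r ∧ ∃ g : E ⊗[𝕜] W →ₗ[𝕜] V,
      (∀ z, ‖g z‖ ≤ projSeminorm r q z) ∧ ∀ z, g ((i : I →ₗ[𝕜] E).rTensor W z) = b z := by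
  obtain ⟨κ, hκ⟩ := hext.exists_extend_toLocal hQ a ha
  choose τ hτ hτa using fun x => exists_extend_localBanach q (b ∘ₗ TensorProduct.mk 𝕜 I W x) (hb x)
  have hext' : ∀ S S' : LocalBanach q →L[𝕜] V, (∀ v, S (toLocalₗ q v) = S' (toLocalₗ q v)) →
      S = S' := fun S S' h =>
    ContinuousLinearMap.coeFn_injective
      ((denseRange_toLocalₗ q).equalizer S.continuous S'.continuous (funext h))
  let τ' : I →ₗ[𝕜] (LocalBanach q →L[𝕜] V) :=
    { toFun := τ
      map_add' := fun x y => hext' _ _ fun v => by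
        rw [add_apply, hτ, hτ, hτ]
        exact (congrArg b (TensorProduct.add_tmul x y v)).trans (map_add b _ _)
      map_smul' := fun c x => hext' _ _ fun v => by
        rw [RingHom.id_apply, smul_apply, hτ, hτ]
        exact (congrArg b (TensorProduct.smul_tmul' c x v)).symm.trans (map_smul b _ _) }
  obtain ⟨T', hT'τ, hT'⟩ := exists_extend_localBanach a τ' (C := 1) fun x => by
    rw [one_mul]
    exact (τ x).opNorm_le_bound (apply_nonneg a x) (hτa x)
  let T : E →L[𝕜] (LocalBanach q →L[𝕜] V) := T'.comp κ
  have hTi : ∀ x, T (i x) = τ x := fun x => by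
    change T' (κ (i x)) = τ x
    rw [hκ, hT'τ]
    rfl
  have hTb : ∀ x v, ‖T x (toLocalₗ q v)‖ ≤ ‖κ x‖ * q v := fun x v => by
    refine ((T x).le_opNorm _).trans ?_
    rw [norm_toLocalₗ]
    exact mul_le_mul_of_nonneg_right ((hT' (κ x)).trans (one_mul _).le) (apply_nonneg q v)
  let g : E ⊗[𝕜] W →ₗ[𝕜] V := TensorProduct.lift
    (LinearMap.mk₂ 𝕜 (fun x v => T x (toLocalₗ q v))
      (fun x y v => by rw [map_add, add_apply]) (fun c x v => by rw [map_smul, smul_apply])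
      (fun x v v' => by rw [map_add, map_add]) (fun c x v => by rw [map_smul, map_smul]))
  refine ⟨(normSeminorm 𝕜 (LocalBanach a)).comp κ.toLinearMap,
    continuous_norm.comp κ.continuous, g, fun z => ?_, fun z => ?_⟩
  · refine (le_projSeminorm_of_tmul_le ((normSeminorm 𝕜 V).comp g) (fun x v => ?_)
      zero_le_one z).trans (one_mul _).le
    rw [one_mul]
    exact hTb x v
  · induction z using TensorProduct.induction_on with
    | zero => simp
    | tmul x v => exact (congrArg (fun S : LocalBanach q →L[𝕜] V => S (toLocalₗ q v)) (hTi x)).trans (hτ x v)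
    | add z z' hz hz' => rw [map_add, map_add, map_add, hz, hz']

end LocalExtension

/-! ### Tensor products of extensions -/

section TensorExact

variable {𝕜 : Type u₁} [RCLike 𝕜]

theorem exists_lift_costSum_lt {E : Type u₂} [AddCommGroup E] [Module 𝕜 E]
    {Q : Type u₃} [AddCommGroup Q] [Module 𝕜 Q] {W : Type v} [AddCommGroup W] [Module 𝕜 W]
    (p : E →ₗ[𝕜] Q) (hp : Function.Surjective p) (s : Seminorm 𝕜 E) (w : Seminorm 𝕜 W)
    (l : List (Q × W)) {c : ℝ} (h : costSum (quotSeminorm p hp s) w l < c) :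
    ∃ l' : List (E × W), l'.map (fun a => (p a.1, a.2)) = l ∧ costSum s w l' < c := by
  induction l generalizing c with
  | nil => exact ⟨[], rfl, by simpa [costSum] using h⟩
  | cons a l ih =>
    obtain ⟨x, v⟩ := a
    have h1 : quotSeminorm p hp s x * w v < c - costSum (quotSeminorm p hp s) w l := by
      have : costSum (quotSeminorm p hp s) w ((x, v) :: l) =
        quotSeminorm p hp s x * w v + costSum (quotSeminorm p hp s) w l := by simp [costSum]
      linarith
    obtain ⟨e, he, hes⟩ :
        ∃ e, p e = x ∧ s e * w v < c - costSum (quotSeminorm p hp s) w l := by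
      rcases (apply_nonneg w v).eq_or_lt with hw | hw
      · obtain ⟨e, he⟩ := hp x
        rw [← hw, mul_zero] at h1
        exact ⟨e, he, by rwa [← hw, mul_zero]⟩
      · rw [← lt_div_iff₀ hw] at h1
        obtain ⟨e, he, hes⟩ := exists_lift_lt_of_quotSeminorm_lt p hp s h1
        exact ⟨e, he, (lt_div_iff₀ hw).1 hes⟩
    obtain ⟨l', hl', hc⟩ := ih (c := c - s e * w v) (by linarith)
    refine ⟨(e, v) :: l', by simp [hl', he], ?_⟩
    have : costSum s w ((e, v) :: l') = s e * w v + costSum s w l' := by simp [costSum]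
    linarith

/-- The quotient seminorm of `s ⊗ w` is bounded by `s' ⊗ w`, where `s'` is the quotient seminorm
of `s`. -/
theorem isOpenMap_rTensorL {E : Type u₂} [AddCommGroup E] [Module 𝕜 E] [TopologicalSpace E]
    {Q : Type u₃} [AddCommGroup Q] [Module 𝕜 Q] [TopologicalSpace Q]
    [IsTopologicalAddGroup Q] [ContinuousSMul 𝕜 Q]
    (p : E →L[𝕜] Q) (hp : Function.Surjective p) (ho : IsOpenMap p)
    (W : Type v) [AddCommGroup W] [Module 𝕜 W] [TopologicalSpace W] :
    IsOpenMap (rTensorL p W) := by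
  refine (IsTopologicalAddGroup.isOpenMap_iff_nhds_zero
    (f := (rTensorL p W : ProjTensor 𝕜 E W →+ ProjTensor 𝕜 Q W))).2 fun U hU => ?_
  obtain ⟨S, hS, hSU⟩ := exists_seminorm_ball_subset (𝕜 := 𝕜) (Filter.mem_map.1 hU)
  obtain ⟨⟨s, w⟩, hsw⟩ := exists_le_projFamily S hS
  let q : {q : Seminorm 𝕜 Q // Continuous q} :=
    ⟨quotSeminorm (p : E →ₗ[𝕜] Q) hp s.1, continuous_quotSeminorm (p : E →ₗ[𝕜] Q) hp s.1 ho s.2⟩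
  refine Filter.mem_of_superset (((projFamily 𝕜 Q W (q, w)).ball_mem_nhds
    ((withSeminorms_projFamily 𝕜 Q W).continuous_seminorm _) one_pos)) fun z hz => ?_
  rw [Seminorm.mem_ball_zero] at hz
  obtain ⟨l, hl, hlc⟩ := exists_costSum_lt_of_projSeminorm_lt hz
  obtain ⟨l', hl', hc⟩ := exists_lift_costSum_lt (p : E →ₗ[𝕜] Q) hp s.1 w.1 l hlc
  have hz' : rTensorL p W (tensorSum 𝕜 l' : E ⊗[𝕜] W) = z := by
    change (p : E →ₗ[𝕜] Q).rTensor W (tensorSum 𝕜 l') = z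
    rw [← hl, ← hl']
    simp [tensorSum, map_list_sum, Function.comp_def]
  rw [← hz']
  exact hSU (S.mem_ball_zero.2 ((hsw _).trans_lt ((projSeminorm_le s.1 w.1 l').trans_lt hc)))

theorem isUniformInducing_of_le_comap {G : Type u₂} {H : Type u₃} [AddCommGroup G] [UniformSpace G]
    [IsUniformAddGroup G] [AddCommGroup H] [UniformSpace H] [IsUniformAddGroup H] (f : G →+ H)
    (hf : Continuous f) (h : (𝓝 (0 : H)).comap f ≤ 𝓝 0) : IsUniformInducing f := by
  refine isUniformInducing_iff'.2 ⟨uniformContinuous_addMonoidHom_of_continuous hf, ?_⟩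
  rw [uniformity_eq_comap_nhds_zero H, uniformity_eq_comap_nhds_zero G, Filter.comap_comap]
  have : (fun x : H × H => x.2 - x.1) ∘ Prod.map f f = f ∘ fun x : G × G => x.2 - x.1 := by
    ext x
    simp
  rw [this, ← Filter.comap_comap]
  exact Filter.comap_mono h

variable {I : Type u₂} [AddCommGroup I] [Module 𝕜 I] [TopologicalSpace I]
variable {E : Type u₃} [AddCommGroup E] [Module 𝕜 E] [UniformSpace E] [IsUniformAddGroup E]
  [FrechetSpace 𝕜 E]
variable {Q : Type u₄} [AddCommGroup Q] [Module 𝕜 Q] [UniformSpace Q] [IsUniformAddGroup Q]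
  [FrechetSpace 𝕜 Q]
variable {i : I →L[𝕜] E} {p : E →L[𝕜] Q}

/-- `a ⊗ w` is the norm of the canonical map from `I ⊗ W` to its local Banach space; as this map
extends to `E ⊗ W` with a bound `r ⊗ w`, the seminorm `a ⊗ w` is bounded by `r ⊗ w` on `I ⊗ W`. -/
theorem IsExtension.isUniformInducing_rTensorL (hext : IsExtension i p)
    (hQ : IsNuclearSpace 𝕜 Q) (W : Type v) [AddCommGroup W] [Module 𝕜 W] [TopologicalSpace W] :
    IsUniformInducing (rTensorL i W) := by
  refine isUniformInducing_of_le_comap (rTensorL i W : ProjTensor 𝕜 I W →+ ProjTensor 𝕜 E W)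
    (rTensorL i W).continuous fun U hU => ?_
  obtain ⟨S, hS, hSU⟩ := exists_seminorm_ball_subset (𝕜 := 𝕜) hU
  obtain ⟨⟨a, w⟩, haw⟩ := exists_le_projFamily S hS
  let A : Seminorm 𝕜 (I ⊗[𝕜] W) := projSeminorm a.1 w.1
  obtain ⟨r, hr, g, hg, hgi⟩ := hext.exists_extend_bilinear hQ (toLocalₗ A) a.1 a.2 w.1
    fun x v => (norm_toLocalₗ A _).trans_le (projSeminorm_tmul_le a.1 w.1 x v)
  refine ⟨(projFamily 𝕜 E W (⟨r, hr⟩, w)).ball 0 1, Seminorm.ball_mem_nhds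
    ((withSeminorms_projFamily 𝕜 E W).continuous_seminorm _) one_pos, fun z hz => hSU ?_⟩
  rw [Set.mem_preimage, Seminorm.mem_ball_zero] at hz
  rw [Seminorm.mem_ball_zero]
  refine ((haw z).trans ?_).trans_lt hz
  change A z ≤ projSeminorm r w.1 ((i : I →ₗ[𝕜] E).rTensor W z)
  rw [← norm_toLocalₗ A z, ← hgi z]
  exact hg _

theorem IsExtension.isUniformEmbedding_tensorMap (hext : IsExtension i p)
    (hQ : IsNuclearSpace 𝕜 Q) (W : Type v) [AddCommGroup W] [Module 𝕜 W] [TopologicalSpace W] :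
    IsUniformEmbedding (tensorMap i W) :=
  (Completion.isUniformInducing_extension ((Completion.isUniformInducing_coe _).comp
    (hext.isUniformInducing_rTensorL hQ W))).isUniformEmbedding

/-- Exactness in the middle: the kernel of `p ⊗̂ W` is the closure of the kernel of `p ⊗ W`, which is
the image of `I ⊗ W`; the image of `I ⊗̂ W` is complete and hence closed. -/
theorem IsExtension.tensorMap (hext : IsExtension i p) (hQ : IsNuclearSpace 𝕜 Q)
    (W : Type v) [AddCommGroup W] [Module 𝕜 W] [UniformSpace W] [IsUniformAddGroup W]
    [hW : FrechetSpace 𝕜 W] : IsExtension (tensorMap i W) (tensorMap p W) := by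
  have := FrechetSpace.metrizable (𝕜 := 𝕜) (E := E)
  have := FrechetSpace.metrizable (𝕜 := 𝕜) (E := W)
  have hemb := hext.isUniformEmbedding_tensorMap hQ W
  have hrs : Function.Surjective (rTensorL p W) :=
    LinearMap.rTensor_surjective W (g := (p : E →ₗ[𝕜] Q)) hext.surjective
  have hrex : Function.Exact ((i : I →ₗ[𝕜] E).rTensor W) ((p : E →ₗ[𝕜] Q).rTensor W) :=
    rTensor_exact W hext.exact hext.surjective
  obtain ⟨ho, hs, hk⟩ := completion_isOpenMap_surjective_ker (rTensorL p W)
    (isOpenMap_rTensorL p hext.surjective hext.isOpenMap W) hrs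
  refine ⟨hemb.isEmbedding, fun z => ⟨fun hz => ?_, ?_⟩, hs, ho⟩
  · rw [← hemb.isClosedEmbedding.isClosed_range.closure_eq]
    refine closure_mono ?_ (hk z hz)
    rintro _ ⟨x, hx, rfl⟩
    obtain ⟨y, rfl⟩ := (hrex x).1 hx
    exact ⟨toCompletedTensor 𝕜 I W y, ContinuousLinearMap.completion_apply_coe (rTensorL i W) y⟩
  · rintro ⟨y, rfl⟩
    induction y using Completion.induction_on with
    | hp =>
      exact isClosed_eq ((FrechetExt.tensorMap p W).continuous.comp
        (FrechetExt.tensorMap i W).continuous) continuous_const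
    | ih y =>
      have h1 : FrechetExt.tensorMap i W (y : CompletedTensor 𝕜 I W) =
        toCompletedTensor 𝕜 E W (rTensorL i W y) :=
        ContinuousLinearMap.completion_apply_coe (rTensorL i W) y
      have h2 : rTensorL p W (rTensorL i W y) = 0 := (hrex _).2 ⟨y, rfl⟩
      rw [h1]
      refine (ContinuousLinearMap.completion_apply_coe (rTensorL p W) _).trans ?_
      rw [h2]
      exact Completion.coe_zero

theorem IsExtension.exists_extend_banach (hext : IsExtension i p) (hQ : IsNuclearSpace 𝕜 Q)
    {V : Type w} [NormedAddCommGroup V] [NormedSpace 𝕜 V] [CompleteSpace V] (f : I →L[𝕜] V) :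
    ∃ g : E →L[𝕜] V, g.comp i = f := by
  let a : Seminorm 𝕜 I := (normSeminorm 𝕜 V).comp f.toLinearMap
  obtain ⟨κ, hκ⟩ := hext.exists_extend_toLocal hQ a (continuous_norm.comp f.continuous)
  obtain ⟨g, hg, -⟩ := exists_extend_localBanach a f.toLinearMap (C := 1) fun x =>
    (one_mul _).ge
  exact ⟨g.comp κ, ContinuousLinearMap.ext fun x => (congrArg g (hκ x)).trans (hg x)⟩

theorem IsExtension.exists_extend_tensorMap_banach (hext : IsExtension i p)
    (hQ : IsNuclearSpace 𝕜 Q) (W : Type v) [AddCommGroup W] [Module 𝕜 W] [TopologicalSpace W]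
    {V : Type w} [NormedAddCommGroup V] [NormedSpace 𝕜 V] [CompleteSpace V]
    (f : CompletedTensor 𝕜 I W →L[𝕜] V) :
    ∃ g : CompletedTensor 𝕜 E W →L[𝕜] V, g.comp (FrechetExt.tensorMap i W) = f := by
  obtain ⟨⟨a, w⟩, haw⟩ := exists_le_projFamily
    ((normSeminorm 𝕜 V).comp (f.comp (toCompletedTensor 𝕜 I W)).toLinearMap)
    (continuous_norm.comp (f.comp (toCompletedTensor 𝕜 I W)).continuous)
  let b : I ⊗[𝕜] W →ₗ[𝕜] V := (f.comp (toCompletedTensor 𝕜 I W)).toLinearMap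
  obtain ⟨r, hr, g, hg, hgb⟩ := hext.exists_extend_bilinear hQ b a.1 a.2 w.1 fun x v =>
    (haw (x ⊗ₜ[𝕜] v : I ⊗[𝕜] W)).trans (projSeminorm_tmul_le a.1 w.1 x v)
  let G' : ProjTensor 𝕜 E W →ₗ[𝕜] V := g
  have hGc : Continuous G' := by
    refine continuous_of_continuousAt_zero G' ?_
    rw [ContinuousAt, map_zero]
    refine squeeze_zero_norm (a := projFamily 𝕜 E W (⟨r, hr⟩, w)) hg ?_
    exact ((withSeminorms_projFamily 𝕜 E W).continuous_seminorm (⟨r, hr⟩, w)).tendsto' 0 0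
      (map_zero _)
  let G : ProjTensor 𝕜 E W →L[𝕜] V := ⟨G', hGc⟩
  refine ⟨G.fromCompletion, ContinuousLinearMap.ext fun z => ?_⟩
  induction z using Completion.induction_on with
  | hp => exact isClosed_eq (by fun_prop) (by fun_prop)
  | ih z =>
    have h1 : FrechetExt.tensorMap i W (z : CompletedTensor 𝕜 I W) =
      toCompletedTensor 𝕜 E W (rTensorL i W z) :=
      ContinuousLinearMap.completion_apply_coe (rTensorL i W) z
    rw [ContinuousLinearMap.comp_apply, h1]
    exact (G.fromCompletion_apply_coe _).trans (hgb z)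

end TensorExact

end FrechetExt

theorem theorem2 {𝕜 : Type u₁} [RCLike 𝕜]
    {I : Type u₂} [AddCommGroup I] [Module 𝕜 I] [UniformSpace I] [IsUniformAddGroup I]
    [FrechetExt.FrechetSpace 𝕜 I]
    {E : Type u₃} [AddCommGroup E] [Module 𝕜 E] [UniformSpace E] [IsUniformAddGroup E]
    [FrechetExt.FrechetSpace 𝕜 E]
    {Q : Type u₄} [AddCommGroup Q] [Module 𝕜 Q] [UniformSpace Q] [IsUniformAddGroup Q]
    [FrechetExt.FrechetSpace 𝕜 Q]
    (i : I →L[𝕜] E) (p : E →L[𝕜] Q) (hext : FrechetExt.IsExtension i p)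
    (hQ : FrechetExt.IsNuclearSpace 𝕜 Q) :
    FrechetExt.IsPure.{u₁, u₂, u₃, u₄, v} i p ∧
      FrechetExt.IsPureIndLocallySplit.{u₁, u₂, u₃, u₄, v, w} i p ∧
      FrechetExt.IsPureProLocallySplit.{u₁, u₂, u₃, u₄, v, w} i p := by
  have := FrechetExt.FrechetSpace.metrizable (𝕜 := 𝕜) (E := E)
  have := FrechetExt.FrechetSpace.metrizable (𝕜 := 𝕜) (E := Q)
  have := FrechetExt.FrechetSpace.complete (𝕜 := 𝕜) (E := E)
  have happ := hQ.approxLiftable p hext.surjective hext.isOpenMap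
  refine ⟨⟨hext, fun W => hext.tensorMap hQ W⟩,
    ⟨⟨hext, fun V _ _ _ f _ => happ.exists_lift f⟩, fun W _ _ _ _ _ =>
      ⟨hext.tensorMap hQ W, fun V _ _ _ f _ => ?_⟩⟩,
    ⟨⟨hext, fun V _ _ _ f => hext.exists_extend_banach hQ f⟩, fun W _ _ _ _ _ =>
      ⟨hext.tensorMap hQ W, fun V _ _ _ f => hext.exists_extend_tensorMap_banach hQ W f⟩⟩⟩
  have := FrechetExt.FrechetSpace.metrizable (𝕜 := 𝕜) (E := W)
  have := FrechetExt.FrechetSpace.metrizable (𝕜 := 𝕜) (E := (FrechetExt.CompletedTensor 𝕜 E W))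
  have := FrechetExt.FrechetSpace.metrizable (𝕜 := 𝕜) (E := (FrechetExt.CompletedTensor 𝕜 Q W))
  exact (happ.tensorMap W).exists_lift f
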